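/- Let $X$ be a compact (Hausdorff) complex manifold of dimension $n$ with a smooth Hermitian metric $g$, i.e. a smooth Riemannian metric invariant under the complex structure $J$. Let $\omega(v,w)=g(Jv,w)$ be its fundamental form and $d$ its geodesic distance (the infimum of lengths of $C^1$ paths, equal to $+\infty$ for points in different components). Let $l>0$ and let $\kappa:[0,l]\to[0,\infty)$ be a modulus of continuity: continuous, nondecreasing, subadditive ($\kappa(s+t)\le\kappa(s)+\kappa(t)$ when $s,t\ge 0$, $s+t\le l$), $\kappa(0)=0$ and $\kappa(t)>0$ for $t>0$. Assume that there is $A>0$ with $$\limsup_{t\to0^+}\frac{4n\,\kappa(At)}{A\,\kappa(t)}<1 .$$ Let $\rho\ge 0$ be a bounded radial Borel function on $\mathbb C^n$, supported in the closed unit ball, with $\int\rho\,d\lambda=1$. For a biholomorphism $F:U\to\Omega$ from an open set $U\subset X$ onto a bounded domain $\Omega\subset\mathbb C^n$, put $\Omega_\delta=\{z\in\Omega:\operatorname{dist}(z,\partial\Omega)>\delta\}$, $U_\delta=F^{-1}(\Omega_\delta)$ and $$\mathcal R_\delta\varphi(x)=\int_{\mathbb B}\varphi\bigl(F^{-1}(F(x)+\delta\xi)\bigr)\rho(\xi)\,d\lambda(\xi),\qquad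 x\in U_\delta,$$ where $\mathbb B$ is the unit ball and $\lambda$ is Lebesgue measure. Let $\varphi:X\to\mathbb R$ be bounded and $\omega$-plurisubharmonic, that is, locally the sum of a plurisubharmonic and a smooth function, with $\omega+dd^c\varphi\ge0$ in the sense of currents, where $dd^c=2i\partial\bar\partial$. Assume that for every $x_0\in X$ there are such a chart $F:U\to\Omega$ with $x_0\in U$, $F(x_0)=0$, and constants $C_1>0$, $0<\delta_1\le l$ such that $$\mathcal R_\delta\varphi(x)-\varphi(x)\le C_1\,\kappa(\delta)\qquad\text{for all }0<\delta<\delta_1\text{ and }x\in U_\delta .$$ Then there is a constant $C_2>0$ such that $$|\varphi(x)-\varphi(y)|\le C_2\,\kappa\bigl(\min\{d(x,y),l\}\bigr)\qquad\text{for all }x,y\in X .$$ -/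

import Mathlib

open Set Filter Topology MeasureTheory Manifold Bundle
open scoped ContDiff

/-- The model space `ℂⁿ` with its Euclidean norm and Lebesgue measure. -/
abbrev Cn (n : ℕ) : Type := EuclideanSpace ℂ (Fin n)

/-- A complex manifold is in particular a smooth real manifold, for the same charts. -/
instance instRealManifoldOfComplex {n : ℕ} {X : Type*} [TopologicalSpace X] [ChartedSpace (Cn n) X]
    [IsManifold 𝓘(ℂ, Cn n) ω X] : IsManifold 𝓘(ℝ, Cn n) ∞ X := by
  apply isManifold_of_contDiffOn
  intro e e' he he'
  have h : e.symm.trans e' ∈ contDiffGroupoid ω 𝓘(ℂ, Cn n) := HasGroupoid.compatible he he'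
  have h1 := (contDiffGroupoid ω 𝓘(ℂ, Cn n)).mem_iff_of_eqOnSource (Setoid.refl _) |>.1 h
  rw [contDiffGroupoid, mem_groupoid_of_pregroupoid] at h1
  exact (ContDiffOn.restrict_scalars ℝ h1.1).of_le le_top

/-! ### Moduli of continuity -/

/-- `κ` is a modulus of continuity on `[0, l]`: continuous, nondecreasing, subadditive, vanishing at
`0` and positive elsewhere. Only the values of `κ` on `[0, l]` matter. -/
structure IsModulusOfContinuity (l : ℝ) (κ : ℝ → ℝ) : Prop where
  length_pos : 0 < l
  continuousOn : ContinuousOn κ (Icc 0 l)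
  monotoneOn : MonotoneOn κ (Icc 0 l)
  subadditive : ∀ s t : ℝ, 0 ≤ s → 0 ≤ t → s + t ≤ l → κ (s + t) ≤ κ s + κ t
  map_zero : κ 0 = 0
  pos : ∀ t ∈ Ioc 0 l, 0 < κ t

/-- The growth condition `limsup_{t → 0⁺} 4 n κ(A t) / (A κ(t)) < 1` for some `A > 0`. For a modulus
of continuity the quotient is nonnegative and, by subadditivity, bounded near `0`, so that the
real-valued `limsup` is the genuine one. -/
def GrowthCondition (n : ℕ) (κ : ℝ → ℝ) : Prop :=
  ∃ A : ℝ, 0 < A ∧ limsup (fun t : ℝ => 4 * n * κ (A * t) / (A * κ t)) (𝓝[>] 0) < 1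

/-! ### Radial kernels and local regularization -/

/-- A nonnegative bounded radial Borel kernel on `ℂⁿ`, supported in the closed unit ball, of
integral `1`. -/
structure IsRadialKernel {n : ℕ} (ρ : Cn n → ℝ) : Prop where
  measurable : Measurable ρ
  nonneg : ∀ ξ, 0 ≤ ρ ξ
  bounded : ∃ M : ℝ, ∀ ξ, ρ ξ ≤ M
  radial : ∀ ξ η, ‖ξ‖ = ‖η‖ → ρ ξ = ρ η
  support : ∀ ξ, 1 < ‖ξ‖ → ρ ξ = 0
  integral_eq_one : ∫ ξ, ρ ξ = 1

/-- `Ω_δ = {z ∈ Ω : dist(z, ∂Ω) > δ}`. -/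
def shrink {n : ℕ} (Ω : Set (Cn n)) (δ : ℝ) : Set (Cn n) :=
  {z ∈ Ω | δ < Metric.infDist z (frontier Ω)}

/-- The regularization `(u ⋆ ρ_δ)(z) = ∫_𝔹 u(z + δ ξ) ρ(ξ) dλ(ξ)`. -/
noncomputable def regularize {n : ℕ} (ρ : Cn n → ℝ) (δ : ℝ) (u : Cn n → ℝ) (z : Cn n) : ℝ :=
  ∫ ξ in Metric.ball (0 : Cn n) 1, u (z + δ • ξ) * ρ ξ

section Manifold

variable {n : ℕ} {X : Type*} [TopologicalSpace X] [ChartedSpace (Cn n) X]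

/-- The regularization `R_δ φ = (φ ∘ F⁻¹)_δ ∘ F` of `φ` in the chart `F`; it is meaningful at the
points of `F⁻¹(Ω_δ)`, where `Ω` is the image of `F`. -/
noncomputable def localRegularization (ρ : Cn n → ℝ) (F : OpenPartialHomeomorph X (Cn n)) (δ : ℝ)
    (φ : X → ℝ) (x : X) : ℝ :=
  regularize ρ δ (fun z => φ (F.symm z)) (F x)

/-- `F` is a biholomorphism from an open neighbourhood of `x₀` onto a bounded domain of `ℂⁿ`,
mapping `x₀` to `0`. -/
structure IsCenteredChart (F : OpenPartialHomeomorph X (Cn n)) (x₀ : X) : Prop where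
  holomorphic : F ∈ IsManifold.maximalAtlas 𝓘(ℂ, Cn n) ω X
  mem_source : x₀ ∈ F.source
  map_center : F x₀ = 0
  bounded : Bornology.IsBounded F.target
  connected : IsConnected F.target

/-- Around every point there is a holomorphic chart centered there in which
`R_δ φ - φ ≤ C₁ κ(δ)` on `U_δ = F⁻¹(Ω_δ)` for all small `δ > 0`. -/
def LocalRegularizationBound (l : ℝ) (κ : ℝ → ℝ) (ρ : Cn n → ℝ) (φ : X → ℝ) : Prop :=
  ∀ x₀ : X, ∃ F : OpenPartialHomeomorph X (Cn n), IsCenteredChart F x₀ ∧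
    ∃ C₁ δ₁ : ℝ, 0 < C₁ ∧ 0 < δ₁ ∧ δ₁ ≤ l ∧
      ∀ δ : ℝ, 0 < δ → δ < δ₁ → ∀ x ∈ F.source, F x ∈ shrink F.target δ →
        localRegularization ρ F δ φ x - φ x ≤ C₁ * κ δ

/-! ### Hermitian metrics -/

/-- The complex structure `J` (multiplication by `i`) on the real tangent space at `x`. Mathlib
identifies that space with `ℂⁿ` through a holomorphic chart, so that `J` is the intrinsic one. -/
noncomputable def tangentJ {x : X} (v : TangentSpace 𝓘(ℝ, Cn n) x) : TangentSpace 𝓘(ℝ, Cn n) x :=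
  (Complex.I • (show Cn n from v) : Cn n)

variable (n X) in
/-- A Hermitian metric on a complex manifold: a smooth Riemannian metric `g` for which `J` is
isometric. It corresponds to the positive `(1,1)`-form `ω(v, w) = g(J v, w)`. -/
structure HermitianMetric [IsManifold 𝓘(ℂ, Cn n) ω X] extends
    ContMDiffRiemannianMetric 𝓘(ℝ, Cn n) ∞ (Cn n) (fun x : X => TangentSpace 𝓘(ℝ, Cn n) x) where
  inner_J : ∀ (x : X) (v w : TangentSpace 𝓘(ℝ, Cn n) x),
    inner x (tangentJ v) (tangentJ w) = inner x v w

/-- The geodesic distance: the infimum of the lengths of `C¹` paths, as an extended number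
(it is infinite exactly for points in different components). -/
noncomputable def HermitianMetric.geodesicEDist [IsManifold 𝓘(ℂ, Cn n) ω X]
    (g : HermitianMetric n X) (x y : X) : ENNReal :=
  letI : RiemannianBundle (fun x : X => TangentSpace 𝓘(ℝ, Cn n) x) :=
    ⟨g.toContMDiffRiemannianMetric.toRiemannianMetric⟩
  riemannianEDist 𝓘(ℝ, Cn n) x y

/-- `g(ξ, ξ)` in the chart `F` at the point `z`, that is, `ω(ξ, J ξ)` for the form `ω` of `g`. -/
noncomputable def HermitianMetric.inChart [IsManifold 𝓘(ℂ, Cn n) ω X]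
    (g : HermitianMetric n X) (F : OpenPartialHomeomorph X (Cn n)) (z ξ : Cn n) : ℝ :=
  g.inner (F.symm z) (mfderiv 𝓘(ℝ, Cn n) 𝓘(ℝ, Cn n) F.symm z ξ)
    (mfderiv 𝓘(ℝ, Cn n) 𝓘(ℝ, Cn n) F.symm z ξ)

end Manifold

/-! ### Plurisubharmonic and `ω`-plurisubharmonic functions -/

/-- A finite-valued plurisubharmonic function on the open set `Ω`: upper semicontinuous, with the
sub-mean value property on every closed complex disc contained in `Ω`. -/
def PlurisubharmonicOn {n : ℕ} (u : Cn n → ℝ) (Ω : Set (Cn n)) : Prop :=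
  UpperSemicontinuousOn u Ω ∧
    ∀ z ξ : Cn n, (∀ ζ : ℂ, ‖ζ‖ ≤ 1 → z + ζ • ξ ∈ Ω) →
      CircleIntegrable (fun ζ : ℂ => u (z + ζ • ξ)) 0 1 ∧
        u z ≤ Real.circleAverage (fun ζ : ℂ => u (z + ζ • ξ)) 0 1

/-- The Laplacian of `χ` along the complex line spanned by `ξ`:
`D²χ(ξ, ξ) + D²χ(iξ, iξ) = 4 ∑ ∂²χ/∂z_j∂z̄_k ξ_j ξ̄_k = (dd^c χ)(ξ, J ξ)`, where `dd^c = 2 i ∂∂̄`. -/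
noncomputable def lineLaplacian {n : ℕ} (χ : Cn n → ℝ) (ξ z : Cn n) : ℝ :=
  iteratedFDeriv ℝ 2 χ z ![ξ, ξ] +
    iteratedFDeriv ℝ 2 χ z ![Complex.I • ξ, Complex.I • ξ]

section Manifold

variable {n : ℕ} {X : Type*} [TopologicalSpace X] [ChartedSpace (Cn n) X]

/-- A finite-valued quasi-plurisubharmonic function: locally, in holomorphic charts, the difference
of a plurisubharmonic and a smooth function. -/
def QuasiPlurisubharmonic (φ : X → ℝ) : Prop :=
  ∀ x₀ : X, ∃ F ∈ IsManifold.maximalAtlas 𝓘(ℂ, Cn n) ω X, x₀ ∈ F.source ∧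
    ∃ w : Cn n → ℝ, ContDiffOn ℝ ∞ w F.target ∧
      PlurisubharmonicOn (fun z => φ (F.symm z) + w z) F.target

/-- `φ` is `ω`-plurisubharmonic for the form `ω` of `g`: it is quasi-plurisubharmonic and
`ω + dd^c φ ≥ 0` in the sense of currents. The latter means that, in every holomorphic chart and for
every constant vector `ξ`, the distribution `ω(ξ, Jξ) + (dd^c φ)(ξ, Jξ)` is nonnegative on
nonnegative test functions. -/
def HermitianMetric.IsPlurisubharmonic [IsManifold 𝓘(ℂ, Cn n) ω X]
    (g : HermitianMetric n X) (φ : X → ℝ) : Prop :=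
  QuasiPlurisubharmonic (n := n) φ ∧
    ∀ F ∈ IsManifold.maximalAtlas 𝓘(ℂ, Cn n) ω X, ∀ (ξ : Cn n) (χ : Cn n → ℝ),
      ContDiff ℝ ∞ χ → HasCompactSupport χ → tsupport χ ⊆ F.target → (∀ z, 0 ≤ χ z) →
        0 ≤ ∫ z, (g.inChart F z ξ * χ z + φ (F.symm z) * lineLaplacian χ ξ z)

end Manifold

/-!
In a chart, `ω + dd^c φ ≥ 0` says that `φ` satisfies the sub-mean value inequality, up to an error
quadratic in the radius, against every nonnegative kernel invariant under unit complex scalars.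
Applied to `ρ ⋆ ρ` minus a multiple of the indicator of a small ball, it turns the assumed bound on
`R_δ φ - φ` into a bound `|φ_s(x) - φ(x)| ≤ C κ(s)` for the averages `φ_s` of `φ` over balls of
radius `s`. If `|x - y| ≤ t`, the ball of radius `(A - 1) t` about `y` lies in the ball of radius
`A t` about `x` and their volumes differ by a factor of at most about `1 + 4 n / A`. Comparing the
averages over these balls bounds the oscillation of `φ` at scale `t` by `4 n / A` times that at
scale `A t`, plus `O(κ(t))`. By the growth condition the bound `D κ` on the oscillation then
descends through the scales `A⁻ᵏ t₀`. Charts are locally Lipschitz for the geodesic distance, and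
compactness gives a uniform constant.
-/

/-! ### Sub-mean values on circles -/

section EllipseMean

theorem hasDerivAt_intervalIntegral_of_continuous {G G' : ℝ → ℝ → ℝ} {a b : ℝ}
    (hG : ∀ r, Continuous (G r)) (hG' : Continuous (Function.uncurry G'))
    (hderiv : ∀ r θ, HasDerivAt (fun s => G s θ) (G' r θ) r) (r : ℝ) :
    HasDerivAt (fun s => ∫ θ in a..b, G s θ) (∫ θ in a..b, G' r θ) r := by
  obtain ⟨B, hB⟩ := ((isCompact_Icc (a := r - 1) (b := r + 1)).prod
    (isCompact_uIcc (a := a) (b := b))).exists_bound_of_continuousOn hG'.continuousOn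
  refine (intervalIntegral.hasDerivAt_integral_of_dominated_loc_of_deriv_le
    (F := G) (F' := G') (s := Icc (r - 1) (r + 1)) (bound := fun _ => B)
    (Icc_mem_nhds (by linarith) (by linarith)) ?_ ?_ ?_ ?_ ?_ ?_).2
  · exact Eventually.of_forall fun s => (hG s).aestronglyMeasurable
  · exact (hG r).intervalIntegrable _ _
  · exact (hG'.comp (Continuous.prodMk_right r)).aestronglyMeasurable
  · exact Eventually.of_forall fun θ hθ s hs => hB (s, θ) ⟨hs, uIoc_subset_uIcc hθ⟩
  · exact intervalIntegrable_const
  · exact Eventually.of_forall fun θ _ s _ => hderiv s θ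

/- In terms of `a`, the hypothesis says `(r a')' ≥ -K r`: the radial form of a lower bound on the
Laplacian in the plane. -/
theorem sub_div_four_le_of_radial_lower_bound {a b c : ℝ → ℝ} {K : ℝ}
    (ha : ∀ r, HasDerivAt a (b r) r) (hb : ∀ r, HasDerivAt b (c r) r)
    (hK : ∀ r ∈ Ioo (0 : ℝ) 1, -(K * r) ≤ b r + r * c r) : a 0 - K / 4 ≤ a 1 := by
  have hflux (r : ℝ) : HasDerivAt (fun s => s * b s + K / 2 * s ^ 2) (b r + r * c r + K * r) r :=
    (((hasDerivAt_id r).mul (hb r)).add ((hasDerivAt_pow 2 r).const_mul (K / 2))).congr_deriv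
      (by simp; ring)
  have hmean (r : ℝ) : HasDerivAt (fun s => a s + K / 4 * s ^ 2) (b r + K / 2 * r) r :=
    ((ha r).add ((hasDerivAt_pow 2 r).const_mul (K / 4))).congr_deriv (by simp; ring)
  have hflux_mono : MonotoneOn (fun s => s * b s + K / 2 * s ^ 2) (Icc 0 1) := by
    refine monotoneOn_of_deriv_nonneg (convex_Icc 0 1)
      (fun r _ => (hflux r).continuousAt.continuousWithinAt)
      (fun r _ => (hflux r).differentiableAt.differentiableWithinAt) fun r hr => ?_
    rw [interior_Icc] at hr
    rw [(hflux r).deriv]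
    linarith [hK r hr]
  have hmean_mono : MonotoneOn (fun s => a s + K / 4 * s ^ 2) (Icc 0 1) := by
    refine monotoneOn_of_deriv_nonneg (convex_Icc 0 1)
      (fun r _ => (hmean r).continuousAt.continuousWithinAt)
      (fun r _ => (hmean r).differentiableAt.differentiableWithinAt) fun r hr => ?_
    rw [interior_Icc] at hr
    rw [(hmean r).deriv]
    have hflux_nonneg := hflux_mono (left_mem_Icc.2 zero_le_one) ⟨hr.1.le, hr.2.le⟩ hr.1.le
    refine nonneg_of_mul_nonneg_right (b := b r + K / 2 * r) ?_ hr.1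
    linear_combination hflux_nonneg
  have h := hmean_mono (left_mem_Icc.2 zero_le_one) (right_mem_Icc.2 zero_le_one) zero_le_one
  linear_combination h

variable {E : Type*} [NormedAddCommGroup E] [NormedSpace ℝ E] {v : E → ℝ} {e f : ℝ → E} {a b : ℝ}

theorem hasDerivAt_integral_along_rays (hv : ContDiff ℝ 1 v) (he : Continuous e) (x : E) (r : ℝ) :
    HasDerivAt (fun s : ℝ => ∫ θ in a..b, v (x + s • e θ))
      (∫ θ in a..b, fderiv ℝ v (x + r • e θ) (e θ)) r := by
  have hcont := hv.continuous
  have := hv.continuous_fderiv one_ne_zero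
  refine hasDerivAt_intervalIntegral_of_continuous (G := fun s θ => v (x + s • e θ))
    (G' := fun s θ => fderiv ℝ v (x + s • e θ) (e θ)) (fun s => by fun_prop) ?_ (fun s θ => ?_) r
  · simp only [Function.uncurry_def]
    fun_prop
  · have hray : HasDerivAt (fun t : ℝ => x + t • e θ) (e θ) s := by
      simpa using ((hasDerivAt_id s).smul_const (e θ)).const_add x
    exact (hv.differentiable one_ne_zero _).hasFDerivAt.comp_hasDerivAt s hray

theorem hasDerivAt_integral_fderiv_along_rays (hv : ContDiff ℝ 2 v) (he : Continuous e) (x : E)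
    (r : ℝ) :
    HasDerivAt (fun s : ℝ => ∫ θ in a..b, fderiv ℝ v (x + s • e θ) (e θ))
      (∫ θ in a..b, fderiv ℝ (fderiv ℝ v) (x + r • e θ) (e θ) (e θ)) r := by
  have hv' : ContDiff ℝ 1 (fderiv ℝ v) := hv.fderiv_right (by norm_num)
  have hcont := hv'.continuous
  have := hv'.continuous_fderiv one_ne_zero
  refine hasDerivAt_intervalIntegral_of_continuous
    (G := fun s θ => fderiv ℝ v (x + s • e θ) (e θ))
    (G' := fun s θ => fderiv ℝ (fderiv ℝ v) (x + s • e θ) (e θ) (e θ))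
    (fun s => by fun_prop) ?_ (fun s θ => ?_) r
  · simp only [Function.uncurry_def]
    fun_prop
  · have hray : HasDerivAt (fun t : ℝ => x + t • e θ) (e θ) s := by
      simpa using ((hasDerivAt_id s).smul_const (e θ)).const_add x
    simpa using ((hv'.differentiable one_ne_zero _).hasFDerivAt.comp_hasDerivAt s hray).clm_apply
      (hasDerivAt_const s (e θ))

/- The difference of the two integrands is the derivative of the periodic function
`θ ↦ Dv(x + r e(θ)) f(θ)`. -/
theorem integral_tangential_eq_integral_normal (hv : ContDiff ℝ 2 v)
    (he : ∀ θ, HasDerivAt e (f θ) θ) (hf : ∀ θ, HasDerivAt f (-e θ) θ)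
    (hclosed_e : e b = e a) (hclosed_f : f b = f a) (x : E) (r : ℝ) :
    ∫ θ in a..b, r * fderiv ℝ (fderiv ℝ v) (x + r • e θ) (f θ) (f θ)
      = ∫ θ in a..b, fderiv ℝ v (x + r • e θ) (e θ) := by
  have hv' : ContDiff ℝ 1 (fderiv ℝ v) := hv.fderiv_right (by norm_num)
  have hcont := hv'.continuous
  have := hv'.continuous_fderiv one_ne_zero
  have hec : Continuous e := continuous_iff_continuousAt.2 fun θ => (he θ).continuousAt
  have hfc : Continuous f := continuous_iff_continuousAt.2 fun θ => (hf θ).continuousAt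
  have hangular (θ : ℝ) : HasDerivAt (fun t => fderiv ℝ v (x + r • e t) (f t))
      (r * fderiv ℝ (fderiv ℝ v) (x + r • e θ) (f θ) (f θ) - fderiv ℝ v (x + r • e θ) (e θ)) θ := by
    have hpath : HasDerivAt (fun t : ℝ => x + r • e t) (r • f θ) θ :=
      ((he θ).const_smul r).const_add x
    refine (((hv'.differentiable one_ne_zero _).hasFDerivAt.comp_hasDerivAt θ hpath).clm_apply
      (hf θ)).congr_deriv ?_
    simp [sub_eq_add_neg]
  rw [← sub_eq_zero, ← intervalIntegral.integral_sub
    (Continuous.intervalIntegrable (by fun_prop) _ _)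
    (Continuous.intervalIntegrable (by fun_prop) _ _),
    intervalIntegral.integral_eq_sub_of_hasDerivAt (fun θ _ => hangular θ)
      (Continuous.intervalIntegrable (by fun_prop) _ _), hclosed_e, hclosed_f, sub_self]

theorem ellipse_submean_of_laplacian_ge (hv : ContDiff ℝ 2 v) (x : E) (hab : a ≤ b)
    (he : ∀ θ, HasDerivAt e (f θ) θ) (hf : ∀ θ, HasDerivAt f (-e θ) θ)
    (hclosed_e : e b = e a) (hclosed_f : f b = f a) {C : ℝ}
    (hC : ∀ r ∈ Icc (0 : ℝ) 1, ∀ θ : ℝ,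
      -C ≤ fderiv ℝ (fderiv ℝ v) (x + r • e θ) (e θ) (e θ)
        + fderiv ℝ (fderiv ℝ v) (x + r • e θ) (f θ) (f θ)) :
    (b - a) * (v x - C / 4) ≤ ∫ θ in a..b, v (x + e θ) := by
  have := (hv.fderiv_right (m := 1) (by norm_num)).continuous_fderiv one_ne_zero
  have hec : Continuous e := continuous_iff_continuousAt.2 fun θ => (he θ).continuousAt
  have hfc : Continuous f := continuous_iff_continuousAt.2 fun θ => (hf θ).continuousAt
  have hradial : ∀ r ∈ Ioo (0 : ℝ) 1, -((b - a) * C * r) ≤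
      (∫ θ in a..b, fderiv ℝ v (x + r • e θ) (e θ))
        + r * ∫ θ in a..b, fderiv ℝ (fderiv ℝ v) (x + r • e θ) (e θ) (e θ) := by
    intro r hr
    rw [← integral_tangential_eq_integral_normal hv he hf hclosed_e hclosed_f x r,
      ← intervalIntegral.integral_const_mul, ← intervalIntegral.integral_add
        (Continuous.intervalIntegrable (by fun_prop) _ _)
        (Continuous.intervalIntegrable (by fun_prop) _ _)]
    calc -((b - a) * C * r) = ∫ _ in a..b, r * -C := by
          rw [intervalIntegral.integral_const, smul_eq_mul]; ring
      _ ≤ _ := by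
          refine intervalIntegral.integral_mono hab intervalIntegrable_const
            (Continuous.intervalIntegrable (by fun_prop) _ _) fun θ => ?_
          linear_combination mul_le_mul_of_nonneg_left (hC r ⟨hr.1.le, hr.2.le⟩ θ) hr.1.le
  have h := sub_div_four_le_of_radial_lower_bound
    (hasDerivAt_integral_along_rays (a := a) (b := b) (hv.of_le one_le_two) hec x)
    (hasDerivAt_integral_fderiv_along_rays hv hec x) hradial
  simp only [zero_smul, add_zero, intervalIntegral.integral_const, smul_eq_mul, one_smul] at h
  linear_combination h

end EllipseMean

section Circle

variable {n : ℕ}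

theorem lineLaplacian_eq_fderiv (χ : Cn n → ℝ) (ξ z : Cn n) :
    lineLaplacian χ ξ z = fderiv ℝ (fderiv ℝ χ) z ξ ξ
      + fderiv ℝ (fderiv ℝ χ) z (Complex.I • ξ) (Complex.I • ξ) := by
  simp [lineLaplacian, iteratedFDeriv_two_apply]

/-- The point `exp (iθ) ξ` of the circle through `ξ` about the origin in the complex line of `ξ`. -/
noncomputable def circlePoint (ξ : Cn n) (θ : ℝ) : Cn n := circleMap 0 1 θ • ξ

theorem continuous_circlePoint : Continuous (Function.uncurry (circlePoint (n := n))) := by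
  simp only [circlePoint, Function.uncurry_def]
  fun_prop

theorem norm_circlePoint (ξ : Cn n) (θ : ℝ) : ‖circlePoint ξ θ‖ = ‖ξ‖ := by
  simp [circlePoint, norm_smul]

theorem circlePoint_two_pi (ξ : Cn n) : circlePoint ξ (2 * Real.pi) = circlePoint ξ 0 := by
  simpa [circlePoint] using congrArg (· • ξ) (periodic_circleMap 0 1 0)

theorem hasDerivAt_circlePoint (ξ : Cn n) (θ : ℝ) :
    HasDerivAt (circlePoint ξ) (Complex.I • circlePoint ξ θ) θ := by
  refine ((hasDerivAt_circleMap 0 1 θ).smul_const ξ).congr_deriv ?_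
  rw [circlePoint, smul_smul, mul_comm]

theorem circle_submean_of_lineLaplacian_ge {v : Cn n → ℝ} (hv : ContDiff ℝ 2 v) (x ξ : Cn n)
    {C : ℝ} (hC : ∀ r ∈ Icc (0 : ℝ) 1, ∀ θ : ℝ,
      -C ≤ lineLaplacian v (circlePoint ξ θ) (x + r • circlePoint ξ θ)) :
    2 * Real.pi * (v x - C / 4) ≤ ∫ θ in (0 : ℝ)..2 * Real.pi, v (x + circlePoint ξ θ) := by
  nth_rewrite 1 [← sub_zero (2 * Real.pi)]
  refine ellipse_submean_of_laplacian_ge hv x Real.two_pi_pos.le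
    (f := fun θ => Complex.I • circlePoint ξ θ) (hasDerivAt_circlePoint ξ) (fun θ => ?_)
    (circlePoint_two_pi ξ) (by simp only [circlePoint_two_pi]) fun r hr θ => ?_
  · refine ((hasDerivAt_circlePoint ξ θ).const_smul Complex.I).congr_deriv ?_
    simp [smul_smul]
  · simpa only [lineLaplacian_eq_fderiv] using hC r hr θ

end Circle

/-! ### Circular kernels -/

section CircularKernel

variable {n : ℕ} {k v : Cn n → ℝ} {b M : ℝ}

/-- An integrable nonnegative kernel on `ℂⁿ`, supported in the closed ball of radius `b`, that is
invariant under multiplication by complex numbers of modulus one. Integration against it averages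
circle means, which is all the sub-mean value property of a plurisubharmonic function sees. -/
structure IsCircularKernel (b : ℝ) (k : Cn n → ℝ) : Prop where
  integrable : Integrable k
  nonneg : ∀ ξ, 0 ≤ k ξ
  circular : ∀ c : ℂ, ‖c‖ = 1 → ∀ ξ, k (c • ξ) = k ξ
  support : ∀ ξ, b < ‖ξ‖ → k ξ = 0

theorem measurePreserving_unit_smul {c : ℂ} (hc : ‖c‖ = 1) :
    MeasurePreserving (fun ξ : Cn n => c • ξ) := by
  have hc0 : c ≠ 0 := by rintro rfl; simp at hc
  let rotation : Cn n ≃ₗᵢ[ℝ] Cn n :=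
    { (LinearEquiv.smulOfNeZero ℂ (Cn n) c hc0).restrictScalars ℝ with
      norm_map' := fun ξ => by
        change ‖c • ξ‖ = ‖ξ‖
        rw [norm_smul, hc, one_mul] }
  exact rotation.measurePreserving

theorem integral_unit_smul {c : ℂ} (hc : ‖c‖ = 1) (f : Cn n → ℝ) :
    ∫ ξ, f (c • ξ) = ∫ ξ, f ξ := by
  have hc0 : c ≠ 0 := by rintro rfl; simp at hc
  exact (measurePreserving_unit_smul hc).integral_comp
    (MeasurableEquiv.smul₀ c hc0).measurableEmbedding f

theorem IsCircularKernel.two_pi_mul_integral (hk : IsCircularKernel b k) (hv : Continuous v)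
    (hM : ∀ ξ, |v ξ| ≤ M) :
    2 * Real.pi * ∫ ξ, v ξ * k ξ
      = ∫ ξ, (∫ θ in (0 : ℝ)..2 * Real.pi, v (circlePoint ξ θ)) * k ξ := by
  have hrotate (θ : ℝ) : ∫ ξ, v (circlePoint ξ θ) * k ξ = ∫ ξ, v ξ * k ξ := by
    have hunit : ‖circleMap 0 1 θ‖ = 1 := by simp
    rw [← integral_unit_smul hunit (fun ξ => v ξ * k ξ)]
    simp only [circlePoint, hk.circular _ hunit]
  have hint : Integrable (Function.uncurry fun (θ : ℝ) (ξ : Cn n) => v (circlePoint ξ θ) * k ξ)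
      ((volume.restrict (uIoc 0 (2 * Real.pi))).prod volume) := by
    have : IsFiniteMeasure (volume.restrict (uIoc 0 (2 * Real.pi))) := by
      rw [uIoc]; infer_instance
    refine (hk.integrable.comp_snd (volume.restrict (uIoc 0 (2 * Real.pi)))).bdd_mul (c := M)
      ?_ (Eventually.of_forall fun p => hM _)
    exact (hv.comp (continuous_circlePoint.comp continuous_swap)).aestronglyMeasurable
  have hswap := intervalIntegral_integral_swap hint
  simpa only [hrotate, intervalIntegral.integral_const, sub_zero, smul_eq_mul,
    intervalIntegral.integral_mul_const] using hswap

theorem IsCircularKernel.integrable_circle_integral_mul (hk : IsCircularKernel b k)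
    (hv : Continuous v) (hM : ∀ ξ, |v ξ| ≤ M) :
    Integrable fun ξ => (∫ θ in (0 : ℝ)..2 * Real.pi, v (circlePoint ξ θ)) * k ξ := by
  refine hk.integrable.bdd_mul (c := M * |2 * Real.pi - 0|) ?_ (Eventually.of_forall fun ξ =>
    intervalIntegral.norm_integral_le_of_norm_le_const fun θ _ => hM _)
  exact (intervalIntegral.continuous_parametric_intervalIntegral_of_continuous'
    (f := fun ξ θ => v (circlePoint ξ θ)) (hv.comp continuous_circlePoint) _ _).aestronglyMeasurable

theorem IsCircularKernel.submean_of_lineLaplacian_ge (hk : IsCircularKernel b k)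
    (hv : ContDiff ℝ 2 v) (hM : ∀ z, |v z| ≤ M) {C : ℝ} (hC : 0 ≤ C) (x : Cn n)
    (hlap : ∀ z, ‖z - x‖ ≤ b → ∀ ξ, -(C * ‖ξ‖ ^ 2) ≤ lineLaplacian v ξ z) :
    (∫ ξ, k ξ) * (v x - C * b ^ 2 / 4) ≤ ∫ ξ, v (x + ξ) * k ξ := by
  have hcont : Continuous fun ξ => v (x + ξ) := hv.continuous.comp (by fun_prop)
  have hcircle (ξ : Cn n) (hξ : ‖ξ‖ ≤ b) : 2 * Real.pi * (v x - C * b ^ 2 / 4)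
      ≤ ∫ θ in (0 : ℝ)..2 * Real.pi, v (x + circlePoint ξ θ) := by
    refine circle_submean_of_lineLaplacian_ge hv x ξ fun r hr θ => ?_
    refine le_trans ?_ (hlap _ ?_ _)
    · rw [norm_circlePoint]
      gcongr
    · rw [add_sub_cancel_left, norm_smul, norm_circlePoint, Real.norm_of_nonneg hr.1]
      exact (mul_le_of_le_one_left (norm_nonneg ξ) hr.2).trans hξ
  have hmono : ∫ ξ, 2 * Real.pi * (v x - C * b ^ 2 / 4) * k ξ ≤
      ∫ ξ, (∫ θ in (0 : ℝ)..2 * Real.pi, v (x + circlePoint ξ θ)) * k ξ := by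
    refine integral_mono (hk.integrable.const_mul _)
      (hk.integrable_circle_integral_mul hcont fun ξ => hM _) fun ξ => ?_
    rcases lt_or_ge b ‖ξ‖ with hξ | hξ
    · simp [hk.support ξ hξ]
    · exact mul_le_mul_of_nonneg_right (hcircle ξ hξ) (hk.nonneg ξ)
  rw [integral_const_mul, ← hk.two_pi_mul_integral hcont fun ξ => hM _] at hmono
  refine le_of_mul_le_mul_left ?_ Real.two_pi_pos
  linear_combination hmono

theorem IsCircularKernel.comp_inv_smul (hk : IsCircularKernel b k) {δ : ℝ} (hδ : 0 < δ) :
    IsCircularKernel (b * δ) fun ξ => k (δ⁻¹ • ξ) where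
  integrable := hk.integrable.comp_smul (inv_ne_zero hδ.ne')
  nonneg _ := hk.nonneg _
  circular c hc ξ := by rw [smul_comm, hk.circular c hc]
  support ξ hξ := hk.support _ <| by
    rwa [norm_smul, norm_inv, Real.norm_of_nonneg hδ.le, inv_mul_eq_div, lt_div_iff₀ hδ]

end CircularKernel

/-! ### Mollification -/

section Mollification

open scoped Convolution
open ContinuousLinearMap (mul)

variable {E : Type*} [NormedAddCommGroup E] [NormedSpace ℝ E]

theorem fderiv_comp_const_sub {F : Type*} [NormedAddCommGroup F] [NormedSpace ℝ F]
    {f : E → F} (hf : Differentiable ℝ f) (x : E) :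
    fderiv ℝ (fun s => f (x - s)) = fun s => -fderiv ℝ f (x - s) := by
  ext s w
  have h := (hf (x - s)).hasFDerivAt.comp s ((hasFDerivAt_id s).const_sub x)
  rw [show (fun s => f (x - s)) = f ∘ fun s => x - s from rfl, h.fderiv]
  simp

theorem fderiv_fderiv_apply {η : E → ℝ} (hη : ContDiff ℝ 2 η) (x ξ ζ : E) :
    fderiv ℝ (fderiv ℝ η) x ξ ζ = fderiv ℝ (fun z => fderiv ℝ η z ζ) x ξ := by
  have hη' : ContDiff ℝ 1 (fderiv ℝ η) := hη.fderiv_right (by norm_num)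
  rw [((hη'.differentiable one_ne_zero x).hasFDerivAt.clm_apply (hasFDerivAt_const ζ x)).fderiv]
  simp

section Convolution

variable [MeasurableSpace E] [BorelSpace E] [FiniteDimensional ℝ E] {μ : Measure E}
  [μ.IsAddHaarMeasure] {u η : E → ℝ}

theorem fderiv_convolution_apply (hu : LocallyIntegrable u μ) (hη : ContDiff ℝ 1 η)
    (hc : HasCompactSupport η) (x ξ : E) :
    fderiv ℝ (u ⋆[mul ℝ ℝ, μ] η) x ξ = (u ⋆[mul ℝ ℝ, μ] fun z => fderiv ℝ η z ξ) x := by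
  rw [(hc.hasFDerivAt_convolution_right (mul ℝ ℝ) hu hη x).fderiv]
  exact convolution_precompR_apply _ hu (hc.fderiv ℝ) (hη.continuous_fderiv one_ne_zero) x ξ

theorem fderiv_fderiv_convolution_apply (hu : LocallyIntegrable u μ) (hη : ContDiff ℝ 2 η)
    (hc : HasCompactSupport η) (x ξ ζ : E) :
    fderiv ℝ (fderiv ℝ (u ⋆[mul ℝ ℝ, μ] η)) x ξ ζ
      = (u ⋆[mul ℝ ℝ, μ] fun z => fderiv ℝ (fderiv ℝ η) z ξ ζ) x := by
  have hη' : ContDiff ℝ 1 fun z => fderiv ℝ η z ζ :=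
    (hη.fderiv_right (by norm_num)).clm_apply contDiff_const
  have hc' : HasCompactSupport fun z => fderiv ℝ η z ζ :=
    (hc.fderiv ℝ).comp_left (g := fun L : E →L[ℝ] ℝ => L ζ) rfl
  rw [fderiv_fderiv_apply (hc.contDiff_convolution_right (n := 2) _ hu hη)]
  simp only [fderiv_convolution_apply hu (hη.of_le one_le_two) hc, fderiv_fderiv_apply hη]
  exact fderiv_convolution_apply hu hη' hc' x ξ

variable (μ) in
/-- The mollification of `u` by a smooth bump function of integral one. -/
noncomputable def mollify (u : E → ℝ) (φ : ContDiffBump (0 : E)) : E → ℝ :=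
  u ⋆[mul ℝ ℝ, μ] φ.normed μ

theorem contDiff_mollify (hu : LocallyIntegrable u μ) (φ : ContDiffBump (0 : E)) :
    ContDiff ℝ ∞ (mollify μ u φ) :=
  φ.hasCompactSupport_normed.contDiff_convolution_right (n := ⊤) _ hu φ.contDiff_normed

theorem abs_mollify_le {M : ℝ} (hM : ∀ z, |u z| ≤ M) (φ : ContDiffBump (0 : E)) (x : E) :
    |mollify μ u φ x| ≤ M := by
  have hint : Integrable (fun s => M * φ.normed μ (x - s)) μ :=
    (φ.integrable_normed.comp_sub_left x).const_mul _
  calc |mollify μ u φ x| ≤ ∫ s, M * φ.normed μ (x - s) ∂μ := by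
        rw [mollify, convolution_mul, ← Real.norm_eq_abs]
        refine norm_integral_le_of_norm_le hint (Eventually.of_forall fun s => ?_)
        rw [norm_mul, Real.norm_eq_abs,
          Real.norm_of_nonneg (φ.nonneg_normed _)]
        exact mul_le_mul_of_nonneg_right (hM s) (φ.nonneg_normed _)
    _ = M := by
        rw [integral_const_mul, integral_sub_left_eq_self (φ.normed μ) μ x, φ.integral_normed,
          mul_one]

/-- A sequence of bump functions shrinking to the origin. -/
noncomputable def shrinkingBump (E : Type*) [NormedAddCommGroup E] (j : ℕ) :
    ContDiffBump (0 : E) where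
  rIn := 1 / (j + 1)
  rOut := 2 / (j + 1)
  rIn_pos := by positivity
  rIn_lt_rOut := by gcongr; norm_num

theorem tendsto_shrinkingBump_rOut (E : Type*) [NormedAddCommGroup E] :
    Tendsto (fun j => (shrinkingBump E j).rOut) atTop (𝓝 0) := by
  simpa [shrinkingBump, div_eq_mul_inv] using
    (tendsto_one_div_add_atTop_nhds_zero_nat (𝕜 := ℝ)).const_mul 2

theorem ae_tendsto_mollify (hu : LocallyIntegrable u μ) :
    ∀ᵐ x ∂μ, Tendsto (fun j => mollify μ u (shrinkingBump E j) x) atTop (𝓝 (u x)) := by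
  have hswap (φ : ContDiffBump (0 : E)) (x : E) :
      mollify μ u φ x = (φ.normed μ ⋆[ContinuousLinearMap.lsmul ℝ ℝ, μ] u) x := by
    rw [convolution_lsmul_swap]
    simp only [mollify, convolution_mul, smul_eq_mul, mul_comm]
  simp only [hswap]
  refine ContDiffBump.ae_convolution_tendsto_right_of_locallyIntegrable (K := 2)
    (tendsto_shrinkingBump_rOut E) (Eventually.of_forall fun j => ?_) hu
  simp [shrinkingBump, div_eq_mul_inv]

theorem tendsto_integral_mollify (hu : LocallyIntegrable u μ) {M : ℝ} (hM : ∀ z, |u z| ≤ M)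
    {k : E → ℝ} (hk : Integrable k μ) (x : E) :
    Tendsto (fun j => ∫ ξ, mollify μ u (shrinkingBump E j) (x + ξ) * k ξ ∂μ) atTop
      (𝓝 (∫ ξ, u (x + ξ) * k ξ ∂μ)) := by
  refine tendsto_integral_of_dominated_convergence (fun ξ => M * |k ξ|) (fun j => ?_)
    (hk.abs.const_mul M) (fun j => Eventually.of_forall fun ξ => ?_) ?_
  · have hcont := (contDiff_mollify hu (shrinkingBump E j)).continuous
    exact Continuous.aestronglyMeasurable (by fun_prop) |>.mul hk.aestronglyMeasurable
  · rw [Real.norm_eq_abs, abs_mul]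
    exact mul_le_mul_of_nonneg_right (abs_mollify_le hM _ _) (abs_nonneg _)
  · filter_upwards [(measurePreserving_add_left μ x).quasiMeasurePreserving.ae
      (ae_tendsto_mollify hu)] with ξ hξ using hξ.mul_const _

end Convolution

variable {n : ℕ} {u η : Cn n → ℝ} {R C : ℝ}

theorem continuous_lineLaplacian (hη : ContDiff ℝ 2 η) (ξ : Cn n) :
    Continuous (lineLaplacian η ξ) := by
  have := (hη.fderiv_right (m := 1) (by norm_num)).continuous_fderiv one_ne_zero
  rw [funext (lineLaplacian_eq_fderiv η ξ)]
  fun_prop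

theorem hasCompactSupport_lineLaplacian (hc : HasCompactSupport η) (ξ : Cn n) :
    HasCompactSupport (lineLaplacian η ξ) := by
  rw [funext (lineLaplacian_eq_fderiv η ξ)]
  exact ((hc.fderiv ℝ).fderiv ℝ).comp_left (g := fun L : Cn n →L[ℝ] Cn n →L[ℝ] ℝ =>
    L ξ ξ + L (Complex.I • ξ) (Complex.I • ξ)) (by simp)

theorem integrable_mul_lineLaplacian (hu : LocallyIntegrable u) (hη : ContDiff ℝ 2 η)
    (hc : HasCompactSupport η) (ξ : Cn n) : Integrable fun z => u z * lineLaplacian η ξ z := by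
  simpa only [smul_eq_mul, mul_comm] using hu.integrable_smul_left_of_hasCompactSupport
    (continuous_lineLaplacian hη ξ) (hasCompactSupport_lineLaplacian hc ξ)

theorem lineLaplacian_comp_const_sub (hη : ContDiff ℝ 2 η) (x ξ t : Cn n) :
    lineLaplacian (fun s => η (x - s)) ξ t = lineLaplacian η ξ (x - t) := by
  have hη' : ContDiff ℝ 1 (fderiv ℝ η) := hη.fderiv_right (by norm_num)
  rw [lineLaplacian_eq_fderiv, lineLaplacian_eq_fderiv,
    fderiv_comp_const_sub (hη.differentiable two_ne_zero), fderiv_fun_neg,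
    fderiv_comp_const_sub (hη'.differentiable one_ne_zero), neg_neg]

theorem lineLaplacian_convolution (hu : LocallyIntegrable u) (hη : ContDiff ℝ 2 η)
    (hc : HasCompactSupport η) (x ξ : Cn n) :
    lineLaplacian (u ⋆[mul ℝ ℝ, volume] η) ξ x = (u ⋆[mul ℝ ℝ, volume] lineLaplacian η ξ) x := by
  have := (hη.fderiv_right (m := 1) (by norm_num)).continuous_fderiv one_ne_zero
  have hexists (ζ : Cn n) : ConvolutionExists u (fun z => fderiv ℝ (fderiv ℝ η) z ζ ζ)
      (mul ℝ ℝ) := by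
    have hcs : HasCompactSupport fun z => fderiv ℝ (fderiv ℝ η) z ζ ζ :=
      ((hc.fderiv ℝ).fderiv ℝ).comp_left
        (g := fun L : Cn n →L[ℝ] Cn n →L[ℝ] ℝ => L ζ ζ) (by simp)
    exact hcs.convolutionExists_right _ hu (by fun_prop)
  simp only [lineLaplacian_eq_fderiv, fderiv_fderiv_convolution_apply hu hη hc]
  rw [funext (lineLaplacian_eq_fderiv η ξ)]
  exact (congrFun ((hexists ξ).distrib_add (hexists (Complex.I • ξ))) x).symm

/-- `dd^c u ≥ -C` in the sense of distributions on the ball of radius `R` about the origin, tested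
on constant vectors. -/
def DistribLineLaplacianGe (u : Cn n → ℝ) (R C : ℝ) : Prop :=
  ∀ (ξ : Cn n) (χ : Cn n → ℝ), ContDiff ℝ ∞ χ → HasCompactSupport χ →
    tsupport χ ⊆ Metric.ball 0 R → (∀ z, 0 ≤ χ z) →
      0 ≤ ∫ z, (C * ‖ξ‖ ^ 2 * χ z + u z * lineLaplacian χ ξ z)

theorem tsupport_normed_const_sub_subset (φ : ContDiffBump (0 : Cn n)) {x : Cn n}
    (hx : ‖x‖ + φ.rOut < R) :
    tsupport (fun s => φ.normed volume (x - s)) ⊆ Metric.ball 0 R := by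
  have hsub : tsupport (fun s => φ.normed volume (x - s)) ⊆ Metric.closedBall x φ.rOut := by
    refine closure_minimal (fun s hs => ?_) Metric.isClosed_closedBall
    have hmem : x - s ∈ Function.support (φ.normed volume) := hs
    rw [φ.support_normed_eq, mem_ball_zero_iff] at hmem
    rw [mem_closedBall_iff_norm']
    exact hmem.le
  refine hsub.trans (Metric.closedBall_subset_ball' ?_)
  rwa [dist_zero_right, add_comm]

theorem lineLaplacian_mollify_ge (hu : LocallyIntegrable u) (hD : DistribLineLaplacianGe u R C)
    (φ : ContDiffBump (0 : Cn n)) {x : Cn n} (hx : ‖x‖ + φ.rOut < R) (ξ : Cn n) :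
    -(C * ‖ξ‖ ^ 2) ≤ lineLaplacian (mollify volume u φ) ξ x := by
  set η := φ.normed volume
  have hη : ContDiff ℝ ∞ η := φ.contDiff_normed
  have hη₂ : ContDiff ℝ 2 η := φ.contDiff_normed
  have hχ : ContDiff ℝ ∞ fun s => η (x - s) := hη.comp (contDiff_const.sub contDiff_id)
  have hχc : HasCompactSupport fun s => η (x - s) :=
    φ.hasCompactSupport_normed.comp_homeomorph (Homeomorph.subLeft x)
  have htest := hD ξ _ hχ hχc (tsupport_normed_const_sub_subset φ hx) fun s => φ.nonneg_normed _
  rw [integral_add ((hχ.continuous.integrable_of_hasCompactSupport hχc).const_mul _)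
      (integrable_mul_lineLaplacian hu (contDiff_infty.1 hχ 2) hχc ξ),
    integral_const_mul, integral_sub_left_eq_self η volume x, φ.integral_normed] at htest
  rw [mollify, lineLaplacian_convolution hu hη₂ φ.hasCompactSupport_normed, convolution_mul]
  simp only [lineLaplacian_comp_const_sub hη₂] at htest
  linear_combination htest

theorem IsCircularKernel.ae_submean {k : Cn n → ℝ} {b : ℝ} (hk : IsCircularKernel b k)
    (hu : LocallyIntegrable u) {M : ℝ} (hM : ∀ z, |u z| ≤ M) (hC : 0 ≤ C)
    (hD : DistribLineLaplacianGe u R C) :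
    ∀ᵐ x, ‖x‖ + b < R → (∫ ξ, k ξ) * (u x - C * b ^ 2 / 4) ≤ ∫ ξ, u (x + ξ) * k ξ := by
  filter_upwards [ae_tendsto_mollify hu] with x hx hxR
  refine le_of_tendsto_of_tendsto ((hx.sub_const _).const_mul _)
    (tendsto_integral_mollify hu hM hk.integrable x) ?_
  filter_upwards [(tendsto_shrinkingBump_rOut (Cn n)).eventually_lt_const
    (show (0 : ℝ) < R - (‖x‖ + b) by linarith)] with j hj
  refine hk.submean_of_lineLaplacian_ge (contDiff_infty.1 (contDiff_mollify hu _) 2)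
    (abs_mollify_le hM _) hC x fun z hz ξ => lineLaplacian_mollify_ge hu hD _ ?_ ξ
  linarith [norm_le_norm_add_norm_sub' z x]

end Mollification

/-! ### From almost every point to every point -/

section Continuity

open scoped Convolution

variable {E : Type*} [NormedAddCommGroup E] [MeasurableSpace E] [BorelSpace E] {μ : Measure E}

theorem continuous_integral_add_mul_of_hasCompactSupport [μ.IsAddLeftInvariant] {u h : E → ℝ}
    (hu : LocallyIntegrable u μ) (hh : Continuous h) (hc : HasCompactSupport h) :
    Continuous fun x => ∫ ξ, u (x + ξ) * h ξ ∂μ := by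
  have hconv : Continuous (u ⋆[ContinuousLinearMap.mul ℝ ℝ, μ] fun y => h (-y)) :=
    (hc.comp_homeomorph (Homeomorph.neg E)).continuous_convolution_right _ hu (by fun_prop)
  refine hconv.congr fun x => ?_
  rw [convolution_mul, ← integral_add_left_eq_self _ x]
  simp only [sub_add_cancel_left, neg_neg]

theorem continuous_integral_add_mul [NormedSpace ℝ E] [FiniteDimensional ℝ E]
    [μ.IsAddHaarMeasure] {u k : E → ℝ} (hu : Measurable u) {M : ℝ}
    (hM : ∀ z, |u z| ≤ M) (hk : Integrable k μ) :
    Continuous fun x => ∫ ξ, u (x + ξ) * k ξ ∂μ := by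
  have hM0 : 0 ≤ M := (abs_nonneg _).trans (hM 0)
  have hloc : LocallyIntegrable u μ :=
    (memLp_top_of_bound hu.aestronglyMeasurable M (Eventually.of_forall hM)).locallyIntegrable
      le_top
  have hint {h : E → ℝ} (hh : Integrable h μ) (x : E) :
      Integrable (fun ξ => u (x + ξ) * h ξ) μ :=
    hh.bdd_mul (c := M) (hu.comp (measurable_const_add x)).aestronglyMeasurable
      (Eventually.of_forall fun ξ => hM _)
  refine continuous_of_uniform_approx_of_continuous fun s hs => ?_
  obtain ⟨ε, hε, hεs⟩ := Metric.mem_uniformity_dist.1 hs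
  obtain ⟨h, hc, hkh, hh, hhi⟩ :=
    hk.exists_hasCompactSupport_integral_sub_le (ε := ε / (M + 1)) (by positivity)
  refine ⟨_, continuous_integral_add_mul_of_hasCompactSupport hloc hh hc, fun x => hεs ?_⟩
  rw [Real.dist_eq, ← integral_sub (hint hk x) (hint hhi x), ← Real.norm_eq_abs]
  calc ‖∫ ξ, (u (x + ξ) * k ξ - u (x + ξ) * h ξ) ∂μ‖
      ≤ ∫ ξ, M * ‖k ξ - h ξ‖ ∂μ := by
        refine norm_integral_le_of_norm_le ((hk.sub hhi).norm.const_mul M)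
          (Eventually.of_forall fun ξ => ?_)
        rw [← mul_sub, norm_mul]
        exact mul_le_mul_of_nonneg_right (hM _) (norm_nonneg _)
    _ ≤ M * (ε / (M + 1)) := by
        rw [integral_const_mul]
        gcongr
    _ < ε := by
        rw [mul_div_assoc', div_lt_iff₀ (by positivity)]
        linarith

end Continuity

/-- Values of `u` arbitrarily close to `u x`, or larger, occur arbitrarily near `x` off any null
set: the property of (quasi-)plurisubharmonic functions that turns inequalities almost everywhere
into inequalities everywhere. -/
def EssentiallyAttainedAt {E : Type*} [TopologicalSpace E] [MeasurableSpace E] (μ : Measure E)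
    (u : E → ℝ) (x : E) : Prop :=
  ∀ c < u x, ∃ᶠ y in 𝓝 x ⊓ ae μ, c < u y

namespace EssentiallyAttainedAt

section Topological

variable {E : Type*} [TopologicalSpace E] [MeasurableSpace E] {μ : Measure E} {u v w : E → ℝ}
  {x : E}

theorem congr (hu : EssentiallyAttainedAt μ u x) (huv : u =ᶠ[𝓝 x] v) :
    EssentiallyAttainedAt μ v x := fun c hc =>
  ((hu c (huv.eq_of_nhds ▸ hc)).and_eventually (huv.filter_mono inf_le_left)).mono
    fun _ hy => hy.2 ▸ hy.1

theorem of_add_continuousAt (huw : EssentiallyAttainedAt μ (fun y => u y + w y) x)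
    (hw : ContinuousAt w x) : EssentiallyAttainedAt μ u x := by
  intro c hc
  have hw' : ∀ᶠ y in 𝓝 x ⊓ ae μ, w y < w x + (u x - c) / 2 :=
    (hw.eventually_lt_const (by linarith)).filter_mono inf_le_left
  refine ((huw (c + w x + (u x - c) / 2) (by linarith)).and_eventually hw').mono ?_
  rintro y ⟨huy, hwy⟩
  linarith

theorem le_of_ae_le (hu : EssentiallyAttainedAt μ u x) {m : ℝ → ℝ} (hm : Monotone m)
    (hmc : ContinuousAt m (u x)) (hv : ContinuousAt v x)
    (hle : ∀ᶠ y in 𝓝 x ⊓ ae μ, m (u y) ≤ v y) : m (u x) ≤ v x := by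
  have hlt (c : ℝ) (hc : c < u x) : m c ≤ v x :=
    ge_of_tendsto_of_frequently (hv.tendsto.mono_left inf_le_left)
      (((hu c hc).and_eventually hle).mono fun _ hy => (hm hy.1.le).trans hy.2)
  exact le_of_tendsto (hmc.tendsto.mono_left nhdsWithin_le_nhds)
    (eventually_nhdsWithin_of_forall (s := Iio (u x)) hlt)

end Topological

variable {E : Type*} [NormedAddCommGroup E] [NormedSpace ℝ E] [FiniteDimensional ℝ E]
  [MeasurableSpace E] [BorelSpace E] {μ : Measure E} [μ.IsAddHaarMeasure]

theorem tendsto_nhds_inf_ae_of_differentiableOn_symm {e : OpenPartialHomeomorph E E}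
    (he : DifferentiableOn ℝ e.symm e.target) {z : E} (hz : z ∈ e.source) :
    Tendsto e (𝓝 z ⊓ ae μ) (𝓝 (e z) ⊓ ae μ) := by
  refine tendsto_inf.2 ⟨(e.continuousAt hz).mono_left inf_le_left, fun s hs => ?_⟩
  have hnull : μ (e.symm '' (sᶜ ∩ e.target)) = 0 :=
    addHaar_image_eq_zero_of_differentiableOn_of_addHaar_eq_zero μ (he.mono inter_subset_right)
      (measure_mono_null inter_subset_left hs)
  change ∀ᶠ y in 𝓝 z ⊓ ae μ, e y ∈ s
  filter_upwards [(e.open_source.eventually_mem hz).filter_mono inf_le_left,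
    (measure_eq_zero_iff_ae_notMem.1 hnull).filter_mono inf_le_right] with y hy hy_notMem
  by_contra hys
  exact hy_notMem ⟨e y, ⟨hys, e.map_source hy⟩, e.left_inv hy⟩

theorem of_comp {e : OpenPartialHomeomorph E E} (he : DifferentiableOn ℝ e.symm e.target)
    {v : E → ℝ} {z : E} (hz : z ∈ e.source) (hv : EssentiallyAttainedAt μ (fun y => v (e y)) z) :
    EssentiallyAttainedAt μ v (e z) := fun c hc =>
  (tendsto_nhds_inf_ae_of_differentiableOn_symm he hz).frequently (hv c hc)

end EssentiallyAttainedAt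

theorem IsCircularKernel.submean {n : ℕ} {u k : Cn n → ℝ} {b M R C : ℝ} (hk : IsCircularKernel b k)
    (hu : Measurable u) (hM : ∀ z, |u z| ≤ M) (hC : 0 ≤ C) (hD : DistribLineLaplacianGe u R C)
    {x : Cn n} (hattained : EssentiallyAttainedAt volume u x) (hx : ‖x‖ + b < R) :
    (∫ ξ, k ξ) * (u x - C * b ^ 2 / 4) ≤ ∫ ξ, u (x + ξ) * k ξ := by
  have hloc : LocallyIntegrable u :=
    (memLp_top_of_bound hu.aestronglyMeasurable M (Eventually.of_forall hM)).locallyIntegrable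
      le_top
  have hmono : Monotone fun c => (∫ ξ, k ξ) * (c - C * b ^ 2 / 4) := fun c d hcd =>
    mul_le_mul_of_nonneg_left (by linarith) (integral_nonneg hk.nonneg)
  refine hattained.le_of_ae_le hmono (by fun_prop)
    (continuous_integral_add_mul hu hM hk.integrable).continuousAt ?_
  have hball : ∀ᶠ y in 𝓝 x, ‖y‖ + b < R := (by fun_prop : Continuous fun y : Cn n => ‖y‖ + b)
    |>.continuousAt.eventually_lt_const hx
  filter_upwards [mem_inf_of_left hball, mem_inf_of_right (hk.ae_submean hloc hM hC hD)]
    with y hyR hy using hy hyR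

/-! ### Pointwise values of plurisubharmonic functions -/

section Plurisubharmonic

variable {n : ℕ}

theorem ae_ae_add_circlePoint {p : Cn n → Prop} (hp : ∀ᵐ y, p y) (z : Cn n) :
    ∀ᵐ ξ : Cn n, ∀ᵐ θ : ℝ, p (z + circlePoint ξ θ) := by
  obtain ⟨N, hpN, hN, hN0⟩ := exists_measurable_superset_of_null (ae_iff.1 hp)
  have hfix (θ : ℝ) : ∀ᵐ ξ : Cn n, z + circlePoint ξ θ ∉ N :=
    ((measurePreserving_add_left volume z).comp (measurePreserving_unit_smul
      (c := circleMap 0 1 θ) (by simp))).quasiMeasurePreserving.ae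
      (measure_eq_zero_iff_ae_notMem.1 hN0)
  have hmeas : Measurable fun q : ℝ × Cn n => z + circlePoint q.2 q.1 :=
    (continuous_const.add (continuous_circlePoint.comp continuous_swap)).measurable
  have hswap : ∀ᵐ ξ : Cn n, ∀ᵐ θ : ℝ, z + circlePoint ξ θ ∉ N :=
    (Measure.ae_ae_comm (hmeas hN).compl).1 (Eventually.of_forall hfix)
  filter_upwards [hswap] with ξ hξ
  filter_upwards [hξ] with θ hθ
  by_contra hnot
  exact hθ (hpN hnot)

theorem PlurisubharmonicOn.essentiallyAttainedAt {u : Cn n → ℝ} {Ω : Set (Cn n)}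
    (hu : PlurisubharmonicOn u Ω) (hΩ : IsOpen Ω) {z : Cn n} (hz : z ∈ Ω) :
    EssentiallyAttainedAt volume u z := by
  intro c hc
  by_contra hnot
  obtain ⟨s, hs, t, ht, hst⟩ := mem_inf_iff_superset.1 (not_frequently.1 hnot)
  obtain ⟨r, hr, hball⟩ := Metric.mem_nhds_iff.1 (inter_mem hs (hΩ.mem_nhds hz))
  -- A small circle about `z` that meets the null set `tᶜ` in a null set.
  obtain ⟨ξ, hξt, hξr⟩ := ((ae_ae_add_circlePoint ht z).and_frequently (frequently_ae_mem_iff.2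
    (Metric.measure_ball_pos volume (0 : Cn n) hr).ne')).exists
  rw [mem_ball_zero_iff] at hξr
  obtain ⟨hint, hle⟩ := hu.2 z ξ fun ζ hζ => (hball (by
    rw [mem_ball_iff_norm, add_sub_cancel_left, norm_smul]
    exact (mul_le_of_le_one_left (norm_nonneg ξ) hζ).trans_lt hξr)).2
  have hcircle : ∫ θ in (0 : ℝ)..2 * Real.pi, u (z + circleMap 0 1 θ • ξ) ≤
      ∫ _ in (0 : ℝ)..2 * Real.pi, c := by
    refine intervalIntegral.integral_mono_ae Real.two_pi_pos.le hint intervalIntegrable_const ?_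
    filter_upwards [hξt] with θ hθ
    refine not_lt.1 (hst ⟨(hball ?_).1, hθ⟩)
    rw [mem_ball_iff_norm, add_sub_cancel_left]
    exact (norm_circlePoint ξ θ).trans_lt hξr
  rw [intervalIntegral.integral_const, smul_eq_mul, sub_zero] at hcircle
  rw [Real.circleAverage_def, smul_eq_mul, inv_mul_eq_div, le_div_iff₀ Real.two_pi_pos] at hle
  exact hc.not_ge (le_of_mul_le_mul_left (by linarith) Real.two_pi_pos)

variable {X : Type*} [TopologicalSpace X] [ChartedSpace (Cn n) X] {φ : X → ℝ}

theorem QuasiPlurisubharmonic.upperSemicontinuous (hφ : QuasiPlurisubharmonic (n := n) φ) :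
    UpperSemicontinuous φ := by
  intro x c hc
  obtain ⟨G, -, hx, w, hw, hψ⟩ := hφ x
  have hGx := G.open_target.mem_nhds (G.map_source hx)
  have hψx := hψ.1 (G x) (G.map_source hx) (φ x + w (G x) + (c - φ x) / 2)
    (by simp only [G.left_inv hx]; linarith)
  rw [nhdsWithin_eq_nhds.2 hGx] at hψx
  have hwx : ∀ᶠ z in 𝓝 (G x), w (G x) - (c - φ x) / 2 < w z :=
    (hw.continuousOn.continuousAt hGx).eventually_const_lt (by linarith)
  filter_upwards [(G.continuousAt hx).eventually hψx, (G.continuousAt hx).eventually hwx,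
    G.open_source.mem_nhds hx] with y hψy hwy hy
  simp only [G.left_inv hy] at hψy
  linarith

theorem contDiffOn_symm_trans_of_mem_maximalAtlas [IsManifold 𝓘(ℂ, Cn n) ω X]
    {F G : OpenPartialHomeomorph X (Cn n)} (hF : F ∈ IsManifold.maximalAtlas 𝓘(ℂ, Cn n) ω X)
    (hG : G ∈ IsManifold.maximalAtlas 𝓘(ℂ, Cn n) ω X) :
    ContDiffOn ℝ ∞ (F.symm ≫ₕ G) (F.symm ≫ₕ G).source := by
  have h := StructureGroupoid.compatible_of_mem_maximalAtlas hF hG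
  rw [contDiffGroupoid, mem_groupoid_of_pregroupoid] at h
  have hholo : ContDiffOn ℂ ω (F.symm ≫ₕ G) (F.symm ≫ₕ G).source := by
    simpa [contDiffPregroupoid] using h.1
  exact (hholo.restrict_scalars ℝ).of_le le_top

theorem QuasiPlurisubharmonic.essentiallyAttainedAt [IsManifold 𝓘(ℂ, Cn n) ω X]
    (hφ : QuasiPlurisubharmonic (n := n) φ) {F : OpenPartialHomeomorph X (Cn n)}
    (hF : F ∈ IsManifold.maximalAtlas 𝓘(ℂ, Cn n) ω X) {z : Cn n} (hz : z ∈ F.target) :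
    EssentiallyAttainedAt volume (fun z => φ (F.symm z)) z := by
  obtain ⟨G, hG, hx, w, hw, hψ⟩ := hφ (F.symm z)
  set e := G.symm ≫ₕ F with he
  set z' := G (F.symm z) with hz'
  have hz'G : z' ∈ G.target := G.map_source hx
  have hz'e : z' ∈ e.source := by simp [he, hz', hx, hz]
  have hez' : e z' = z := by simp [he, hz', hx, hz]
  have hinG : EssentiallyAttainedAt volume (fun y => φ (G.symm y)) z' :=
    (hψ.essentiallyAttainedAt G.open_target hz'G).of_add_continuousAt
      (hw.continuousOn.continuousAt (G.open_target.mem_nhds hz'G))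
  have he_symm : DifferentiableOn ℝ e.symm e.target :=
    (contDiffOn_symm_trans_of_mem_maximalAtlas hF hG).differentiableOn (by simp)
  rw [← hez']
  refine EssentiallyAttainedAt.of_comp he_symm hz'e (hinG.congr ?_)
  filter_upwards [e.open_source.mem_nhds hz'e] with y hy
  rw [he, OpenPartialHomeomorph.trans_source] at hy
  simp [he, F.left_inv hy.2]

end Plurisubharmonic

/-! ### Growth of moduli of continuity -/

namespace IsModulusOfContinuity

variable {l : ℝ} {κ : ℝ → ℝ}

theorem nonneg (hκ : IsModulusOfContinuity l κ) {t : ℝ} (ht : t ∈ Icc 0 l) : 0 ≤ κ t :=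
  hκ.map_zero.symm.le.trans (hκ.monotoneOn (left_mem_Icc.2 hκ.length_pos.le) ht ht.1)

theorem natCast_mul_le (hκ : IsModulusOfContinuity l κ) (m : ℕ) {t : ℝ} (ht : 0 ≤ t)
    (hmt : m * t ≤ l) : κ (m * t) ≤ m * κ t := by
  induction m with
  | zero => simp [hκ.map_zero]
  | succ m ih =>
    push_cast at hmt ⊢
    calc κ ((m + 1) * t) = κ (m * t + t) := by ring_nf
      _ ≤ κ (m * t) + κ t := hκ.subadditive _ _ (by positivity) ht (by linarith)
      _ ≤ m * κ t + κ t := by gcongr; exact ih (by linarith)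
      _ = (m + 1) * κ t := by ring

theorem mul_le (hκ : IsModulusOfContinuity l κ) {B t : ℝ} (hB : 0 < B) (ht : t ∈ Icc 0 l)
    (hBt : B * t ≤ l) : κ (B * t) ≤ (B + 1) * κ t := by
  have hm : (0 : ℝ) < ⌈B⌉₊ := by exact_mod_cast Nat.ceil_pos.2 hB
  have hcancel : ⌈B⌉₊ * (B * t / ⌈B⌉₊) = B * t := mul_div_cancel₀ _ hm.ne'
  have h0 : 0 ≤ B * t / ⌈B⌉₊ := div_nonneg (mul_nonneg hB.le ht.1) hm.le
  have hle : B * t / ⌈B⌉₊ ≤ t := by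
    rw [div_le_iff₀ hm, mul_comm t]
    exact mul_le_mul_of_nonneg_right (Nat.le_ceil B) ht.1
  calc κ (B * t) = κ (⌈B⌉₊ * (B * t / ⌈B⌉₊)) := by rw [hcancel]
    _ ≤ ⌈B⌉₊ * κ (B * t / ⌈B⌉₊) := hκ.natCast_mul_le _ h0 (hcancel.trans_le hBt)
    _ ≤ ⌈B⌉₊ * κ t := by gcongr; exact hκ.monotoneOn ⟨h0, hle.trans ht.2⟩ ht hle
    _ ≤ (B + 1) * κ t := mul_le_mul_of_nonneg_right (Nat.ceil_lt_add_one hB.le).le (hκ.nonneg ht)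

theorem exists_le_mul (hκ : IsModulusOfContinuity l κ) :
    ∃ c : ℝ, 0 < c ∧ ∀ t ∈ Icc 0 l, t ≤ c * κ t := by
  have hl := hκ.length_pos
  have hκl : 0 < κ l := hκ.pos l ⟨hl, le_rfl⟩
  refine ⟨2 * l / κ l, by positivity, fun t ht => ?_⟩
  rcases ht.1.eq_or_lt with rfl | ht0
  · rw [hκ.map_zero, mul_zero]
  have hcancel : l / t * t = l := div_mul_cancel₀ _ ht0.ne'
  have hmul : κ l ≤ (l / t + 1) * κ t := by
    simpa only [hcancel] using hκ.mul_le (div_pos hl ht0) ht hcancel.le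
  rw [div_mul_eq_mul_div, le_div_iff₀ hκl]
  calc t * κ l ≤ t * ((l / t + 1) * κ t) := by gcongr
    _ = (l + t) * κ t := by field_simp
    _ ≤ 2 * l * κ t := mul_le_mul_of_nonneg_right (by linarith [ht.2]) (hκ.nonneg ht)

theorem exists_sq_le_mul (hκ : IsModulusOfContinuity l κ) :
    ∃ c : ℝ, 0 < c ∧ ∀ t ∈ Icc 0 l, t ^ 2 ≤ c * κ t := by
  obtain ⟨c, hc, hle⟩ := hκ.exists_le_mul
  refine ⟨l * c, mul_pos hκ.length_pos hc, fun t ht => ?_⟩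
  rw [sq, mul_assoc]
  exact mul_le_mul ht.2 (hle t ht) ht.1 hκ.length_pos.le

theorem eventually_mem_Ioc (hκ : IsModulusOfContinuity l κ) (A : ℝ) :
    ∀ᶠ t in 𝓝[>] (0 : ℝ), t ∈ Ioc 0 l ∧ A * t ≤ l := by
  have hscale : Tendsto (fun t : ℝ => A * t) (𝓝 0) (𝓝 0) := by
    simpa only [mul_zero] using (continuous_const_mul A).tendsto 0
  filter_upwards [Ioc_mem_nhdsGT hκ.length_pos,
    nhdsWithin_le_nhds (hscale.eventually_le_const hκ.length_pos)] with t ht hAt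
  exact ⟨ht, hAt⟩

theorem isBoundedUnder_quotient (hκ : IsModulusOfContinuity l κ) {A : ℝ} (n : ℕ) (hA : 0 < A) :
    IsBoundedUnder (· ≤ ·) (𝓝[>] (0 : ℝ)) fun t => 4 * n * κ (A * t) / (A * κ t) := by
  refine isBoundedUnder_of_eventually_le (a := 4 * n * (A + 1) / A) ?_
  filter_upwards [hκ.eventually_mem_Ioc A] with t ⟨ht, hAt⟩
  have hκt := hκ.pos t ht
  rw [div_le_div_iff₀ (by positivity) hA]
  calc 4 * n * κ (A * t) * A ≤ 4 * n * ((A + 1) * κ t) * A := by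
        gcongr
        exact hκ.mul_le hA (Ioc_subset_Icc_self ht) hAt
    _ = 4 * n * (A + 1) * (A * κ t) := by ring

/- If `A < 1`, subadditivity gives `A κ(τ) ≤ (1 + A) κ(A τ) < 2 κ(A τ)`, which is incompatible with
the contraction; if `A ≥ 1`, monotonicity gives `4 n ≤ q A`. -/
theorem four_mul_lt_of_contraction (hκ : IsModulusOfContinuity l κ) {A q τ : ℝ} {n : ℕ}
    (hn : 0 < n) (hA : 0 < A) (hq : q < 1) (hτ : τ ∈ Ioc 0 l) (hAτ : A * τ ≤ l)
    (hcontr : 4 * n * κ (A * τ) ≤ q * (A * κ τ)) : 4 * n < A := by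
  have hn1 : (1 : ℝ) ≤ n := by exact_mod_cast hn
  have hκτ := hκ.pos τ hτ
  have hAτ0 : 0 < A * τ := mul_pos hA hτ.1
  have hκAτ := hκ.pos _ ⟨hAτ0, hAτ⟩
  have hstrict : 4 * n * κ (A * τ) < A * κ τ := hcontr.trans_lt (by nlinarith [mul_pos hA hκτ])
  rcases le_or_gt 1 A with hA1 | hA1
  · have hmono : κ τ ≤ κ (A * τ) :=
      hκ.monotoneOn (Ioc_subset_Icc_self hτ) ⟨hAτ0.le, hAτ⟩ (by nlinarith [hτ.1])
    have : 4 * n * κ τ < A * κ τ := lt_of_le_of_lt (by gcongr) hstrict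
    exact lt_of_mul_lt_mul_right this hκτ.le
  · have hcancel : A⁻¹ * (A * τ) = τ := inv_mul_cancel_left₀ hA.ne' τ
    have hmul : κ τ ≤ (A⁻¹ + 1) * κ (A * τ) := by
      simpa only [hcancel] using
        hκ.mul_le (inv_pos.2 hA) ⟨hAτ0.le, hAτ⟩ (hcancel.trans_le hτ.2)
    have : A * κ τ ≤ (1 + A) * κ (A * τ) :=
      calc A * κ τ ≤ A * ((A⁻¹ + 1) * κ (A * τ)) := by gcongr
        _ = (1 + A) * κ (A * τ) := by field_simp
    nlinarith

end IsModulusOfContinuity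

theorem GrowthCondition.exists_contraction {n : ℕ} (hn : 0 < n) {l : ℝ} {κ : ℝ → ℝ}
    (hκ : IsModulusOfContinuity l κ) (h : GrowthCondition n κ) :
    ∃ A q τ : ℝ, 4 * n < A ∧ q < 1 ∧ 0 < τ ∧ A * τ ≤ l ∧
      ∀ t, 0 < t → t ≤ τ → 4 * n * κ (A * t) ≤ q * (A * κ t) := by
  obtain ⟨A, hA, hlim⟩ := h
  obtain ⟨q, hlimq, hq⟩ := exists_between hlim
  have hev := (eventually_lt_of_limsup_lt hlimq (hκ.isBoundedUnder_quotient n hA)).and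
    (hκ.eventually_mem_Ioc A)
  obtain ⟨τ, hτ, hsub⟩ := mem_nhdsGT_iff_exists_Ioc_subset.1 hev
  have hcontr : ∀ t, 0 < t → t ≤ τ → 4 * n * κ (A * t) ≤ q * (A * κ t) := by
    intro t ht htτ
    obtain ⟨hlt, htl, -⟩ := hsub ⟨ht, htτ⟩
    exact ((div_lt_iff₀ (mul_pos hA (hκ.pos t htl))).1 hlt).le
  obtain ⟨-, hτl, hAτ⟩ := hsub (right_mem_Ioc.2 hτ)
  exact ⟨A, q, τ, hκ.four_mul_lt_of_contraction hn hA hq hτl hAτ (hcontr τ hτ le_rfl), hq, hτ,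
    hAτ, hcontr⟩

/-! ### The self-convolution of a radial kernel -/

section SelfConvolution

open scoped Convolution

variable {E : Type*} [NormedAddCommGroup E] [NormedSpace ℝ E] [FiniteDimensional ℝ E]
  [MeasurableSpace E] [BorelSpace E] {μ : Measure E} [μ.IsAddHaarMeasure]

theorem integral_mul_convolution {u f g : E → ℝ} {M : ℝ} (hu : Measurable u)
    (hM : ∀ z, |u z| ≤ M) (hf : Integrable f μ) (hg : Integrable g μ) :
    ∫ ζ, u ζ * (f ⋆[ContinuousLinearMap.mul ℝ ℝ, μ] g) ζ ∂μ
      = ∫ ξ, (∫ η, u (ξ + η) * g η ∂μ) * f ξ ∂μ := by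
  have hint : Integrable (Function.uncurry fun ζ ξ => u ζ * (f ξ * g (ζ - ξ))) (μ.prod μ) :=
    (hf.convolution_integrand (ContinuousLinearMap.mul ℝ ℝ) hg).bdd_mul (c := M)
      (hu.comp measurable_fst).aestronglyMeasurable (Eventually.of_forall fun p => hM _)
  have hinner (ξ : E) : ∫ ζ, u ζ * (f ξ * g (ζ - ξ)) ∂μ = (∫ η, u (ξ + η) * g η ∂μ) * f ξ := by
    rw [← integral_add_left_eq_self _ ξ, ← integral_mul_const]
    simp only [add_sub_cancel_left, mul_left_comm, mul_comm]
  simp only [convolution_mul, ← integral_const_mul]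
  rw [integral_integral_swap hint]
  simp only [hinner]

end SelfConvolution

namespace IsRadialKernel

open scoped Convolution

variable {n : ℕ} {ρ : Cn n → ℝ}

theorem integrable (hρ : IsRadialKernel ρ) : Integrable ρ :=
  .of_integral_ne_zero (by simp [hρ.integral_eq_one])

theorem neg_apply (hρ : IsRadialKernel ρ) (ξ : Cn n) : ρ (-ξ) = ρ ξ :=
  hρ.radial _ _ (norm_neg ξ)

theorem integral_sq_pos (hρ : IsRadialKernel ρ) (hint : Integrable fun ξ => ρ ξ * ρ ξ) :
    0 < ∫ ξ, ρ ξ * ρ ξ := by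
  have hsupport : 0 < volume (Function.support ρ) := by
    rw [← integral_pos_iff_support_of_nonneg hρ.nonneg hρ.integrable, hρ.integral_eq_one]
    exact one_pos
  rw [integral_pos_iff_support_of_nonneg (fun ξ => mul_self_nonneg _) hint]
  simpa only [Function.support_mul, inter_self] using hsupport

end IsRadialKernel

/-- The self-convolution `ρ ⋆ ρ`. Unlike `ρ` it is continuous and positive at the origin, so that it
dominates a multiple of the indicator function of a ball. -/
noncomputable def selfConvolution {n : ℕ} (ρ : Cn n → ℝ) : Cn n → ℝ :=
  convolution ρ ρ (ContinuousLinearMap.mul ℝ ℝ) volume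

namespace IsRadialKernel

variable {n : ℕ} {ρ : Cn n → ℝ}

theorem selfConvolution_apply (hρ : IsRadialKernel ρ) (ζ : Cn n) :
    selfConvolution ρ ζ = ∫ ξ, ρ (ζ + ξ) * ρ ξ := by
  rw [selfConvolution, convolution_mul, ← integral_neg_eq_self]
  simp only [hρ.neg_apply, sub_neg_eq_add, mul_comm]

theorem exists_le_selfConvolution (hρ : IsRadialKernel ρ) :
    ∃ c r : ℝ, 0 < c ∧ 0 < r ∧ r ≤ 1 ∧ ∀ ζ, ‖ζ‖ < r → c ≤ selfConvolution ρ ζ := by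
  obtain ⟨M, hM⟩ := hρ.bounded
  have hbound (ξ : Cn n) : |ρ ξ| ≤ M := (abs_of_nonneg (hρ.nonneg ξ)).trans_le (hM ξ)
  have hcont : Continuous (selfConvolution ρ) :=
    (continuous_integral_add_mul hρ.measurable hbound hρ.integrable).congr
      fun ζ => (hρ.selfConvolution_apply ζ).symm
  have hpos : 0 < selfConvolution ρ 0 := by
    simpa only [hρ.selfConvolution_apply, zero_add] using hρ.integral_sq_pos
      (hρ.integrable.bdd_mul hρ.measurable.aestronglyMeasurable (Eventually.of_forall hbound))
  obtain ⟨r, hr, hball⟩ := Metric.eventually_nhds_iff.1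
    (hcont.continuousAt.eventually_const_lt (half_lt_self hpos))
  refine ⟨selfConvolution ρ 0 / 2, min r 1, half_pos hpos, lt_min hr one_pos, min_le_right _ _,
    fun ζ hζ => (hball ?_).le⟩
  rw [dist_zero_right]
  exact hζ.trans_le (min_le_left _ _)

theorem isCircularKernel_selfConvolution (hρ : IsRadialKernel ρ) :
    IsCircularKernel 2 (selfConvolution ρ) where
  integrable := hρ.integrable.integrable_convolution _ hρ.integrable
  nonneg ζ := by
    rw [hρ.selfConvolution_apply]
    exact integral_nonneg fun ξ => mul_nonneg (hρ.nonneg _) (hρ.nonneg _)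
  circular c hc ζ := by
    have hrot (ξ : Cn n) : ρ (c • ξ) = ρ ξ := hρ.radial _ _ (by rw [norm_smul, hc, one_mul])
    rw [hρ.selfConvolution_apply, hρ.selfConvolution_apply, ← integral_unit_smul hc]
    simp only [← smul_add, hrot]
  support ζ hζ := by
    rw [hρ.selfConvolution_apply]
    refine integral_eq_zero_of_ae (Eventually.of_forall fun ξ => ?_)
    rcases lt_or_ge 1 ‖ξ‖ with hξ | hξ
    · simp [hρ.support ξ hξ]
    · have htriangle : ‖ζ‖ ≤ ‖ζ + ξ‖ + ‖ξ‖ := by simpa using norm_sub_le (ζ + ξ) ξ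
      simp [hρ.support (ζ + ξ) (by linarith)]

theorem integral_selfConvolution (hρ : IsRadialKernel ρ) : ∫ ζ, selfConvolution ρ ζ = 1 := by
  rw [selfConvolution, integral_convolution _ hρ.integrable hρ.integrable, hρ.integral_eq_one]
  simp

theorem integral_mul_selfConvolution_le (hρ : IsRadialKernel ρ) {u : Cn n → ℝ} {M B : ℝ}
    (hu : Measurable u) (hM : ∀ z, |u z| ≤ M)
    (hB : ∀ x, ‖x‖ ≤ 1 → ∫ ξ, u (x + ξ) * ρ ξ ≤ u x + B) :
    ∫ ζ, u ζ * selfConvolution ρ ζ ≤ u 0 + 2 * B := by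
  have hint {v : Cn n → ℝ} (hv : Measurable v) (hvM : ∀ z, |v z| ≤ M) :
      Integrable fun ξ => v ξ * ρ ξ :=
    hρ.integrable.bdd_mul hv.aestronglyMeasurable (Eventually.of_forall hvM)
  have hmean (ξ : Cn n) : ‖∫ η, u (ξ + η) * ρ η‖ ≤ M :=
    calc ‖∫ η, u (ξ + η) * ρ η‖ ≤ ∫ η, M * ρ η := by
          refine norm_integral_le_of_norm_le (hρ.integrable.const_mul M)
            (Eventually.of_forall fun η => ?_)
          rw [norm_mul, Real.norm_of_nonneg (hρ.nonneg η)]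
          exact mul_le_mul_of_nonneg_right (hM _) (hρ.nonneg η)
      _ = M := by rw [integral_const_mul, hρ.integral_eq_one, mul_one]
  calc ∫ ζ, u ζ * selfConvolution ρ ζ = ∫ ξ, (∫ η, u (ξ + η) * ρ η) * ρ ξ :=
        integral_mul_convolution hu hM hρ.integrable hρ.integrable
    _ ≤ ∫ ξ, (u ξ * ρ ξ + B * ρ ξ) := by
        have hcont := continuous_integral_add_mul (μ := volume) hu hM hρ.integrable
        refine integral_mono (hint hcont.measurable hmean)
          ((hint hu hM).add (hρ.integrable.const_mul B)) fun ξ => ?_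
        rcases lt_or_ge 1 ‖ξ‖ with hξ | hξ
        · simp [hρ.support ξ hξ]
        · simpa only [add_mul] using mul_le_mul_of_nonneg_right (hB ξ hξ) (hρ.nonneg ξ)
    _ = (∫ ξ, u (0 + ξ) * ρ ξ) + B := by
        rw [integral_add (hint hu hM) (hρ.integrable.const_mul B), integral_const_mul,
          hρ.integral_eq_one, mul_one]
        simp only [zero_add]
    _ ≤ u 0 + 2 * B := by linarith [hB 0 (by simp)]

end IsRadialKernel

/-! ### Averages over balls -/

section BallAverage

variable {E : Type*} [NormedAddCommGroup E] [NormedSpace ℝ E] [FiniteDimensional ℝ E]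
  [MeasurableSpace E] [BorelSpace E] (μ : Measure E) [μ.IsAddHaarMeasure]

open scoped Pointwise in
theorem setAverage_ball_comp_add_smul (u : E → ℝ) (x : E) {δ : ℝ} (hδ : 0 < δ) (r : ℝ) :
    ⨍ ζ in Metric.ball 0 r, u (x + δ • ζ) ∂μ = ⨍ z in Metric.ball x (δ * r), u z ∂μ := by
  have hball : δ • Metric.ball (0 : E) r = (fun z => x + z) ⁻¹' Metric.ball x (δ * r) := by
    rw [smul_ball hδ.ne', smul_zero, Real.norm_of_nonneg hδ.le, preimage_add_ball, sub_self]
  have hint : ∫ ζ in Metric.ball 0 r, u (x + δ • ζ) ∂μ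
      = (δ ^ Module.finrank ℝ E)⁻¹ * ∫ z in Metric.ball x (δ * r), u z ∂μ := by
    rw [Measure.setIntegral_comp_smul_of_pos μ (fun z => u (x + z)) _ hδ, hball, smul_eq_mul,
      (measurePreserving_add_left μ x).setIntegral_preimage_emb (measurableEmbedding_addLeft x)]
  have hvol : μ.real (Metric.ball x (δ * r))
      = δ ^ Module.finrank ℝ E * μ.real (Metric.ball 0 r) := by
    rw [Measure.real, Measure.addHaar_ball_mul_of_pos μ x hδ, ENNReal.toReal_mul,
      ENNReal.toReal_ofReal (by positivity), Measure.real]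
  rw [setAverage_eq, setAverage_eq, hint, hvol, smul_eq_mul, smul_eq_mul, mul_inv, ← mul_assoc,
    mul_comm (μ.real _)⁻¹]

/-- The averages of `u` over balls of radius `s ≤ s₀` with centre in the ball of radius `R` about
the origin differ from the value of `u` at the centre by at most `C κ(s)`. -/
def HasAverageModulus (u : E → ℝ) (κ : ℝ → ℝ) (C R s₀ : ℝ) : Prop :=
  ∀ x, ‖x‖ < R → ∀ s, 0 < s → s ≤ s₀ → |(⨍ z in Metric.ball x s, u z ∂μ) - u x| ≤ C * κ s

end BallAverage

section CircularSubmean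

theorem integral_mul_indicator_one {α : Type*} [MeasurableSpace α] {μ : Measure α} (f : α → ℝ)
    {s : Set α} (hs : MeasurableSet s) : ∫ x, f x * s.indicator 1 x ∂μ = ∫ x in s, f x ∂μ := by
  rw [← integral_indicator hs]
  congr with x
  simp [indicator]

variable {n : ℕ} {u : Cn n → ℝ} {R C : ℝ}

theorem isCircularKernel_indicator_ball (r : ℝ) :
    IsCircularKernel r ((Metric.ball (0 : Cn n) r).indicator 1) where
  integrable := (integrable_indicator_iff measurableSet_ball).2
    (integrableOn_const measure_ball_lt_top.ne)
  nonneg := indicator_nonneg fun _ _ => zero_le_one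
  circular c hc ξ := by
    simp only [indicator, mem_ball_zero_iff, norm_smul, hc, one_mul, Pi.one_apply]
  support ξ hξ := indicator_of_notMem (by simpa using hξ.le) _

theorem IsCircularKernel.sub_indicator_ball {k : Cn n → ℝ} {b c r : ℝ} (hk : IsCircularKernel b k)
    (hr : r ≤ b) (hle : ∀ ξ, ‖ξ‖ < r → c ≤ k ξ) :
    IsCircularKernel b fun ξ => k ξ - c * (Metric.ball (0 : Cn n) r).indicator 1 ξ where
  integrable := hk.integrable.sub ((isCircularKernel_indicator_ball r).integrable.const_mul c)
  nonneg ξ := by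
    by_cases hξ : ξ ∈ Metric.ball (0 : Cn n) r
    · simpa [indicator_of_mem hξ] using hle ξ (mem_ball_zero_iff.1 hξ)
    · simpa [indicator_of_notMem hξ] using hk.nonneg ξ
  circular a ha ξ := by
    rw [hk.circular a ha, (isCircularKernel_indicator_ball r).circular a ha]
  support ξ hξ := by
    rw [hk.support ξ hξ, (isCircularKernel_indicator_ball r).support ξ (hr.trans_lt hξ), mul_zero,
      sub_zero]

/-- The sub-mean value property of `u` on the ball of radius `R` about the origin with respect to
all circular kernels, up to an error `C b²` that is quadratic in the radius `b` of the kernel. -/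
def CircularSubmean (u : Cn n → ℝ) (R C : ℝ) : Prop :=
  ∀ (b : ℝ) (k : Cn n → ℝ), IsCircularKernel b k → ∀ x : Cn n, ‖x‖ + b < R →
    (∫ ξ, k ξ) * (u x - C * b ^ 2) ≤ ∫ ξ, u (x + ξ) * k ξ

namespace CircularSubmean

theorem comp_add_smul (hu : CircularSubmean u R C) (x : Cn n) {δ : ℝ} (hδ : 0 < δ) :
    CircularSubmean (fun z => u (x + δ • z)) ((R - ‖x‖) / δ) (C * δ ^ 2) := by
  intro b k hk y hy
  have hnorm : ‖x + δ • y‖ ≤ ‖x‖ + δ * ‖y‖ := by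
    simpa only [norm_smul, Real.norm_of_nonneg hδ.le] using norm_add_le x (δ • y)
  have hmem : ‖x + δ • y‖ + b * δ < R := by
    rw [lt_div_iff₀ hδ] at hy
    linarith
  have hsubmean := hu _ _ (hk.comp_inv_smul hδ) _ hmem
  have hscale : (∫ ξ, u (x + δ • y + ξ) * k (δ⁻¹ • ξ))
      = |δ ^ Module.finrank ℝ (Cn n)| * ∫ ξ, u (x + δ • (y + ξ)) * k ξ := by
    rw [← smul_eq_mul, ← Measure.integral_comp_inv_smul]
    simp only [smul_add, smul_inv_smul₀ hδ.ne', add_assoc]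
  rw [hscale, Measure.integral_comp_inv_smul volume k, smul_eq_mul, mul_assoc] at hsubmean
  refine (le_of_mul_le_mul_left hsubmean (by positivity)).trans' (le_of_eq ?_)
  ring

theorem le_setAverage_ball (hu : CircularSubmean u R C) {x : Cn n} {s : ℝ} (hs : 0 < s)
    (hx : ‖x‖ + s < R) : u x - C * s ^ 2 ≤ ⨍ z in Metric.ball x s, u z := by
  have hsubmean := hu s _ (isCircularKernel_indicator_ball s) x hx
  have hvol : 0 < volume.real (Metric.ball (0 : Cn n) s) :=
    ENNReal.toReal_pos (Metric.measure_ball_pos volume 0 hs).ne' measure_ball_lt_top.ne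
  have haverage := setAverage_ball_comp_add_smul volume u x one_pos s
  simp only [one_smul, one_mul] at haverage
  rw [integral_indicator_one measurableSet_ball,
    integral_mul_indicator_one _ measurableSet_ball] at hsubmean
  rw [← haverage, setAverage_eq, smul_eq_mul, ← div_eq_inv_mul, le_div_iff₀ hvol]
  linarith

/- The kernel `ρ ⋆ ρ - c 1_B`, `B` the ball, is still circular and nonnegative. By the sub-mean
value property for it, the excess of the mean against `ρ ⋆ ρ` bounds `c` times the excess of the
integral over `B`. -/
theorem setAverage_ball_le (hu : CircularSubmean u R C) (hR : 2 < R) (hC : 0 ≤ C)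
    (hum : Measurable u) {M : ℝ} (hM : ∀ z, |u z| ≤ M) {ρ : Cn n → ℝ} (hρ : IsRadialKernel ρ)
    {c r B : ℝ} (hc : 0 < c) (hr : 0 < r) (hr1 : r ≤ 1)
    (hcr : ∀ ζ, ‖ζ‖ < r → c ≤ selfConvolution ρ ζ)
    (hB : ∀ x, ‖x‖ ≤ 1 → ∫ ξ, u (x + ξ) * ρ ξ ≤ u x + B) :
    ⨍ z in Metric.ball 0 r, u z
      ≤ u 0 + (2 * B + 4 * C) / (c * volume.real (Metric.ball (0 : Cn n) r)) := by
  set V := volume.real (Metric.ball (0 : Cn n) r)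
  have hV : 0 < V :=
    ENNReal.toReal_pos (Metric.measure_ball_pos volume 0 hr).ne' measure_ball_lt_top.ne
  have hσ := hρ.isCircularKernel_selfConvolution
  have hball := isCircularKernel_indicator_ball (n := n) r
  have hint {k : Cn n → ℝ} (hk : Integrable k) : Integrable fun ξ => u ξ * k ξ :=
    hk.bdd_mul hum.aestronglyMeasurable (Eventually.of_forall hM)
  have hmass : ∫ ξ, (selfConvolution ρ ξ - c * (Metric.ball (0 : Cn n) r).indicator 1 ξ)
      = 1 - c * V := by
    rw [integral_sub hσ.integrable (hball.integrable.const_mul c), hρ.integral_selfConvolution,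
      integral_const_mul, integral_indicator_one measurableSet_ball]
  have hmean : ∫ ξ, u ξ * (selfConvolution ρ ξ - c * (Metric.ball (0 : Cn n) r).indicator 1 ξ)
      = (∫ ξ, u ξ * selfConvolution ρ ξ) - c * ∫ ξ in Metric.ball (0 : Cn n) r, u ξ := by
    rw [← integral_mul_indicator_one _ measurableSet_ball, ← integral_const_mul,
      ← integral_sub (hint hσ.integrable) ((hint hball.integrable).const_mul c)]
    simp only [mul_sub, mul_left_comm (u _) c]
  have hsubmean := hu 2 _ (hσ.sub_indicator_ball (by linarith) hcr) 0 (by simpa using hR)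
  simp only [zero_add] at hsubmean
  rw [hmass, hmean] at hsubmean
  have hdouble := hρ.integral_mul_selfConvolution_le hum hM hB
  have hCV : 0 ≤ c * V * (4 * C) := by positivity
  rw [setAverage_eq, smul_eq_mul, ← div_eq_inv_mul, ← sub_le_iff_le_add', div_sub' hV.ne',
    div_le_div_iff₀ hV (by positivity)]
  linear_combination V * (hsubmean + hdouble + hCV)

theorem exists_setAverage_ball_le (hu : CircularSubmean u R C) (hC : 0 ≤ C) (hum : Measurable u)
    {M : ℝ} (hM : ∀ z, |u z| ≤ M) {ρ : Cn n → ℝ} (hρ : IsRadialKernel ρ) {l : ℝ} {κ : ℝ → ℝ}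
    (hκ : IsModulusOfContinuity l κ) {C₁ δ₁ : ℝ} (hC₁ : 0 < C₁) (hδ₁l : δ₁ ≤ l)
    (hbound : ∀ δ, 0 < δ → δ < δ₁ → ∀ x, ‖x‖ + δ < R →
      ∫ ξ, u (x + δ • ξ) * ρ ξ ≤ u x + C₁ * κ δ) :
    ∃ C₂ r : ℝ, 0 < C₂ ∧ 0 < r ∧ r ≤ 1 ∧ ∀ s, 0 < s → s < δ₁ * r → ∀ x, ‖x‖ + 2 * (s / r) < R →
      ⨍ z in Metric.ball x s, u z ≤ u x + C₂ * κ s := by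
  obtain ⟨c, r, hc, hr, hr1, hcr⟩ := hρ.exists_le_selfConvolution
  obtain ⟨L, hL, hsq⟩ := hκ.exists_sq_le_mul
  have hV : 0 < volume.real (Metric.ball (0 : Cn n) r) :=
    ENNReal.toReal_pos (Metric.measure_ball_pos volume 0 hr).ne' measure_ball_lt_top.ne
  set V := volume.real (Metric.ball (0 : Cn n) r)
  refine ⟨(2 * C₁ + 4 * (C * L)) / (c * V) * (r⁻¹ + 1), r, by positivity, hr, hr1,
    fun s hs hsδ x hx => ?_⟩
  obtain ⟨δ, rfl⟩ : ∃ δ, s = δ * r := ⟨s / r, (div_mul_cancel₀ s hr.ne').symm⟩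
  rw [mul_div_cancel_right₀ _ hr.ne'] at hx
  have hδ : 0 < δ := pos_of_mul_pos_left hs hr.le
  have hδδ₁ : δ < δ₁ := lt_of_mul_lt_mul_right hsδ hr.le
  have hδl : δ ∈ Icc 0 l := ⟨hδ.le, hδδ₁.le.trans hδ₁l⟩
  have hregularized (y : Cn n) (hy : ‖y‖ ≤ 1) :
      ∫ ξ, u (x + δ • (y + ξ)) * ρ ξ ≤ u (x + δ • y) + C₁ * κ δ := by
    have hnorm : ‖x + δ • y‖ ≤ ‖x‖ + δ * ‖y‖ := by
      simpa only [norm_smul, Real.norm_of_nonneg hδ.le] using norm_add_le x (δ • y)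
    simpa only [smul_add, add_assoc] using hbound δ hδ hδδ₁ (x + δ • y) (by nlinarith)
  have hunit := (hu.comp_add_smul x hδ).setAverage_ball_le (by rw [lt_div_iff₀ hδ]; linarith)
    (by positivity) (hum.comp (by fun_prop)) (fun z => hM _) hρ hc hr hr1 hcr hregularized
  simp only [setAverage_ball_comp_add_smul volume u x hδ, smul_zero, add_zero] at hunit
  have hκδ : κ δ ≤ (r⁻¹ + 1) * κ (δ * r) := by
    have hcancel : r⁻¹ * (δ * r) = δ := by field_simp
    simpa only [hcancel] using hκ.mul_le (inv_pos.2 hr)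
      ⟨hs.le, (mul_le_of_le_one_right hδ.le hr1).trans hδl.2⟩ (hcancel.trans_le hδl.2)
  calc ⨍ z in Metric.ball x (δ * r), u z
      ≤ u x + (2 * (C₁ * κ δ) + 4 * (C * δ ^ 2)) / (c * V) := hunit
    _ ≤ u x + (2 * (C₁ * κ δ) + 4 * (C * (L * κ δ))) / (c * V) := by gcongr; exact hsq δ hδl
    _ = u x + (2 * C₁ + 4 * (C * L)) / (c * V) * κ δ := by ring
    _ ≤ u x + (2 * C₁ + 4 * (C * L)) / (c * V) * ((r⁻¹ + 1) * κ (δ * r)) := by gcongr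
    _ = _ := by ring

theorem exists_hasAverageModulus {a : ℝ} (hu : CircularSubmean u (4 * a) C) (ha : 0 < a)
    (hC : 0 ≤ C) (hum : Measurable u) {M : ℝ} (hM : ∀ z, |u z| ≤ M) {ρ : Cn n → ℝ}
    (hρ : IsRadialKernel ρ) {l : ℝ} {κ : ℝ → ℝ} (hκ : IsModulusOfContinuity l κ) {C₁ δ₁ : ℝ}
    (hC₁ : 0 < C₁) (hδ₁ : 0 < δ₁) (hδ₁l : δ₁ ≤ l)
    (hbound : ∀ δ, 0 < δ → δ < δ₁ → ∀ x, ‖x‖ + δ < 4 * a →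
      ∫ ξ, u (x + δ • ξ) * ρ ξ ≤ u x + C₁ * κ δ) :
    ∃ C' s₀ : ℝ, 0 ≤ C' ∧ 0 < s₀ ∧ HasAverageModulus volume u κ C' (2 * a) s₀ := by
  obtain ⟨C₂, r, hC₂, hr, hr1, hupper⟩ :=
    hu.exists_setAverage_ball_le hC hum hM hρ hκ hC₁ hδ₁l hbound
  obtain ⟨L, -, hsq⟩ := hκ.exists_sq_le_mul
  refine ⟨max C₂ (C * L), min (δ₁ * r / 2) (a * r / 2), by positivity, by positivity,
    fun x hx s hs hs₀ => ?_⟩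
  obtain ⟨hsδ, hsa⟩ := le_min_iff.1 hs₀
  have : 0 < δ₁ * r := mul_pos hδ₁ hr
  have hsl : s ∈ Icc 0 l := ⟨hs.le, by nlinarith⟩
  have hsr : s / r ≤ a / 2 := by rw [div_le_iff₀ hr]; linarith
  have hκs : 0 ≤ κ s := hκ.nonneg hsl
  have hle : C₂ * κ s ≤ max C₂ (C * L) * κ s := by gcongr; exact le_max_left _ _
  have hge : C * s ^ 2 ≤ max C₂ (C * L) * κ s :=
    calc C * s ^ 2 ≤ C * (L * κ s) := by gcongr; exact hsq s hsl
      _ = C * L * κ s := by ring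
      _ ≤ _ := by gcongr; exact le_max_right _ _
  rw [abs_le]
  constructor
  · linarith [hu.le_setAverage_ball hs (x := x) (by nlinarith)]
  · linarith [hupper s hs (by linarith) x (by linarith)]

end CircularSubmean

end CircularSubmean

/-! ### From averages to a modulus of continuity -/

theorem div_sub_one_pow_le {d : ℕ} {A : ℝ} (hA : 2 * d < A) (hA1 : 1 < A) :
    (A / (A - 1)) ^ d ≤ 1 + 2 * d / A := by
  have hA0 : 0 < A := by linarith
  have hbernoulli : 1 - d / A ≤ ((A - 1) / A) ^ d := by
    have h := one_add_mul_le_pow (a := -(1 / A))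
      (by linarith [(div_le_one hA0).2 hA1.le]) d
    calc 1 - d / A = 1 + d * -(1 / A) := by ring
      _ ≤ (1 + -(1 / A)) ^ d := h
      _ = ((A - 1) / A) ^ d := by congr 1; field_simp; ring
  have hhalf : d / A ≤ 1 / 2 := by rw [div_le_iff₀ hA0]; linarith
  have hnonneg : 0 ≤ d / A := by positivity
  rw [← inv_div, inv_pow, mul_div_assoc]
  refine inv_le_of_inv_le₀ (by positivity) (le_trans ?_ hbernoulli)
  rw [inv_le_iff_one_le_mul₀ (by positivity)]
  nlinarith

theorem exists_scale_near {A t₀ t : ℝ} (hA : 1 < A) (ht : 0 < t) (ht₀ : t ≤ t₀) :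
    ∃ k : ℕ, t ≤ t₀ / A ^ k ∧ t₀ / A ^ (k + 1) ≤ t := by
  have : 0 < A := by linarith
  obtain ⟨k, hle, hlt⟩ := exists_nat_pow_near ((one_le_div ht).2 ht₀) hA
  refine ⟨k, ?_, ?_⟩
  · rwa [le_div_iff₀ (by positivity), mul_comm, ← le_div_iff₀ ht]
  · rw [div_le_iff₀ (by positivity), mul_comm, ← div_le_iff₀ ht]
    exact hlt.le

section Oscillation

variable {E : Type*} [NormedAddCommGroup E]

/-- `u` increases by at most `B` over distances at most `s` from points of the ball of radius `R`
about the origin. -/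
def OscillationLe (u : E → ℝ) (R s B : ℝ) : Prop :=
  ∀ x y, ‖x‖ < R → ‖y - x‖ ≤ s → u y - u x ≤ B

variable {u : E → ℝ}

theorem sub_le_of_forall_oscillationLe_scale {l A D a t₀ : ℝ} {κ : ℝ → ℝ}
    (hκ : IsModulusOfContinuity l κ) (hA : 1 < A) (hD : 0 ≤ D) (ht₀l : t₀ ≤ l)
    (hdouble : ∀ t, 0 < t → A * t ≤ t₀ → κ (A * t) ≤ A * κ t)
    (hosc : ∀ k : ℕ, OscillationLe u a (t₀ / A ^ k) (D * κ (t₀ / A ^ k))) {x y : E} (hx : ‖x‖ < a)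
    (hxy : ‖y - x‖ ≤ t₀) : u y - u x ≤ D * A * κ ‖y - x‖ := by
  rcases eq_or_ne y x with rfl | hne
  · simp [hκ.map_zero]
  have : 0 < A := by linarith
  have hpos : 0 < ‖y - x‖ := norm_sub_pos_iff.2 hne
  have ht₀ : 0 < t₀ := hpos.trans_le hxy
  obtain ⟨k, hle, hge⟩ := exists_scale_near hA hpos hxy
  have hscale : A * (t₀ / A ^ (k + 1)) = t₀ / A ^ k := by rw [pow_succ]; field_simp
  calc u y - u x ≤ D * κ (t₀ / A ^ k) := hosc k x y hx hle
    _ = D * κ (A * (t₀ / A ^ (k + 1))) := by rw [hscale]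
    _ ≤ D * (A * κ (t₀ / A ^ (k + 1))) := by
        gcongr
        exact hdouble _ (by positivity)
          (hscale.trans_le (div_le_self ht₀.le (one_le_pow₀ hA.le)))
    _ ≤ D * (A * κ ‖y - x‖) := by
        gcongr
        exact hκ.monotoneOn ⟨by positivity, hge.trans (hxy.trans ht₀l)⟩
          ⟨hpos.le, hxy.trans ht₀l⟩ hge
    _ = D * A * κ ‖y - x‖ := by ring

variable [NormedSpace ℝ E] [FiniteDimensional ℝ E] [MeasurableSpace E] [BorelSpace E]
  {μ : Measure E} [μ.IsAddHaarMeasure] {M : ℝ}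

theorem setAverage_ball_le_mul_setAverage_ball {f : E → ℝ} {x y : E} {r s : ℝ} (hr : 0 < r)
    (hs : 0 < s) (hsub : Metric.ball y r ⊆ Metric.ball x s)
    (hf : IntegrableOn f (Metric.ball x s) μ) (hnonneg : ∀ z ∈ Metric.ball x s, 0 ≤ f z) :
    ⨍ z in Metric.ball y r, f z ∂μ
      ≤ (s / r) ^ Module.finrank ℝ E * ⨍ z in Metric.ball x s, f z ∂μ := by
  have hvol (p : E) {t : ℝ} (ht : 0 < t) : μ.real (Metric.ball p t)
      = t ^ Module.finrank ℝ E * μ.real (Metric.ball (0 : E) 1) := by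
    rw [Measure.real, Measure.addHaar_ball_of_pos μ p ht, ENNReal.toReal_mul,
      ENNReal.toReal_ofReal (by positivity), Measure.real]
  have hmono : ∫ z in Metric.ball y r, f z ∂μ ≤ ∫ z in Metric.ball x s, f z ∂μ :=
    setIntegral_mono_set hf (ae_restrict_of_forall_mem measurableSet_ball hnonneg)
      hsub.eventuallyLE
  have hV : 0 < μ.real (Metric.ball (0 : E) 1) :=
    ENNReal.toReal_pos (Metric.measure_ball_pos μ 0 one_pos).ne' measure_ball_lt_top.ne
  rw [setAverage_eq, setAverage_eq, hvol y hr, hvol x hs, smul_eq_mul, smul_eq_mul]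
  calc _ ≤ (r ^ Module.finrank ℝ E * μ.real (Metric.ball (0 : E) 1))⁻¹
        * ∫ z in Metric.ball x s, f z ∂μ := by gcongr
    _ = _ := by rw [div_pow]; field_simp

theorem sub_le_of_setAverage_ball (hu : Measurable u) (hM : ∀ z, |u z| ≤ M) {x y : E}
    {r s m e₁ e₂ : ℝ} (hr : 0 < r) (hs : 0 < s) (hsub : Metric.ball y r ⊆ Metric.ball x s)
    (hm : ∀ z ∈ Metric.ball x s, u x - m ≤ u z) (h₁ : u y - e₁ ≤ ⨍ z in Metric.ball y r, u z ∂μ)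
    (h₂ : ⨍ z in Metric.ball x s, u z ∂μ ≤ u x + e₂) :
    u y - u x ≤ e₁ - m + (s / r) ^ Module.finrank ℝ E * (e₂ + m) := by
  have hint (p : E) (t : ℝ) : IntegrableOn u (Metric.ball p t) μ :=
    Measure.integrableOn_of_bounded measure_ball_lt_top.ne hu.aestronglyMeasurable
      (Eventually.of_forall hM)
  have hconst (p : E) (t : ℝ) : IntegrableOn (fun _ => m - u x) (Metric.ball p t) μ :=
    integrableOn_const measure_ball_lt_top.ne
  have haverage (p : E) {t : ℝ} (ht : 0 < t) : ⨍ z in Metric.ball p t, (u z + (m - u x)) ∂μ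
      = (⨍ z in Metric.ball p t, u z ∂μ) + (m - u x) := by
    have hpos := (Metric.measure_ball_pos μ p ht).ne'
    rw [setAverage_eq, integral_add (hint p t) (hconst p t), smul_add, ← setAverage_eq,
      ← setAverage_eq, setAverage_const hpos measure_ball_lt_top.ne]
  have hcompare := setAverage_ball_le_mul_setAverage_ball hr hs hsub
    ((hint x s).add (hconst x s)) fun z hz => by
      simp only [Pi.add_apply]
      linarith [hm z hz]
  simp only [Pi.add_apply] at hcompare
  rw [haverage y hr, haverage x hs] at hcompare
  have hupper : (s / r) ^ Module.finrank ℝ E * ((⨍ z in Metric.ball x s, u z ∂μ) + (m - u x))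
      ≤ (s / r) ^ Module.finrank ℝ E * (e₂ + m) :=
    mul_le_mul_of_nonneg_left (by linarith) (by positivity)
  linarith

variable {l A q C D : ℝ} {κ : ℝ → ℝ}

/- Positivity of `u - u x + D κ(s)` on the ball of radius `s = A w` about `x` transfers the average
bound from that ball to the ball of radius `s - w` about `y`, at the price of the ratio of volumes
`(A / (A - 1)) ^ d ≤ 1 + 2 d / A`. -/
theorem OscillationLe.step {R b w s₀ : ℝ} (hosc : OscillationLe u b (A * w) (D * κ (A * w)))
    (havg : HasAverageModulus μ u κ C R s₀) (hu : Measurable u) (hM : ∀ z, |u z| ≤ M)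
    (hκ : IsModulusOfContinuity l κ) (hA : 2 * Module.finrank ℝ E < A) (hA1 : 1 < A) (hC : 0 ≤ C)
    (hD : 0 ≤ D) (hw : 0 < w) (hbR : b ≤ R) (hws₀ : A * w ≤ s₀) (hwl : A * w ≤ l)
    (hcontr : 2 * Module.finrank ℝ E * κ (A * w) ≤ q * (A * κ w))
    (hdouble : κ (A * w) ≤ A * κ w) (hCD : 3 * C * A ≤ (1 - q) * D) :
    OscillationLe u (b - A * w) w (D * κ w) := by
  intro x y hx hxy
  set s := A * w
  have hA0 : 0 < A := by linarith
  have hws : w < s := lt_mul_of_one_lt_left hw hA1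
  have hnorm (z : E) : ‖z‖ ≤ ‖x‖ + ‖z - x‖ := by simpa using norm_add_le x (z - x)
  have hκs : 0 ≤ κ s := hκ.nonneg ⟨by positivity, hwl⟩
  have hκw : 0 ≤ κ w := hκ.nonneg ⟨hw.le, hws.le.trans hwl⟩
  have hsub : Metric.ball y (s - w) ⊆ Metric.ball x s :=
    Metric.ball_subset_ball' (by rw [dist_eq_norm]; linarith)
  have hlow (z : E) (hz : z ∈ Metric.ball x s) : u x - D * κ s ≤ u z := by
    rw [mem_ball_iff_norm] at hz
    linarith [hosc z x (by linarith [hnorm z]) (by rw [norm_sub_rev]; exact hz.le)]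
  have hκmono : κ (s - w) ≤ κ s :=
    hκ.monotoneOn ⟨by linarith, by linarith⟩ ⟨by linarith, hwl⟩ (by linarith)
  have hy := abs_le.1 (havg y (by linarith [hnorm y]) (s - w) (by linarith) (by linarith))
  have hx := abs_le.1 (havg x (by linarith) s (by linarith) hws₀)
  have hstep := sub_le_of_setAverage_ball (μ := μ) hu hM (e₁ := C * κ s) (by linarith)
    (by linarith) hsub hlow (by nlinarith [hy.1]) (sub_le_iff_le_add'.1 hx.2)
  have hratio : s / (s - w) = A / (A - 1) := by
    rw [← sub_one_mul, mul_div_mul_right _ _ hw.ne']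
  rw [hratio] at hstep
  set ε : ℝ := 2 * Module.finrank ℝ E / A
  have hε : ε ≤ 1 := (div_le_one hA0).2 hA.le
  have hεκ : ε * κ s ≤ q * κ w := by
    rw [div_mul_eq_mul_div, div_le_iff₀ hA0]
    linarith
  calc u y - u x
      ≤ C * κ s - D * κ s + (A / (A - 1)) ^ Module.finrank ℝ E * (C * κ s + D * κ s) := hstep
    _ ≤ C * κ s - D * κ s + (1 + ε) * (C * κ s + D * κ s) := by
        gcongr
        exact div_sub_one_pow_le hA hA1
    _ = (2 + ε) * C * κ s + D * (ε * κ s) := by ring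
    _ ≤ 3 * C * (A * κ w) + D * (q * κ w) := by gcongr; linarith
    _ = 3 * C * A * κ w + q * D * κ w := by ring
    _ ≤ (1 - q) * D * κ w + q * D * κ w := by gcongr
    _ = D * κ w := by ring

theorem HasAverageModulus.oscillationLe_scale {a t₀ : ℝ}
    (havg : HasAverageModulus μ u κ C (2 * a) t₀) (hu : Measurable u) (hM : ∀ z, |u z| ≤ M)
    (hκ : IsModulusOfContinuity l κ) (hA : 2 * Module.finrank ℝ E < A) (hA2 : 2 ≤ A) (hC : 0 ≤ C)
    (hD : 0 ≤ D) (ha : 0 < a) (ht₀ : 0 < t₀) (ht₀a : t₀ ≤ a / 2) (ht₀l : t₀ ≤ l)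
    (hcontr : ∀ t, 0 < t → A * t ≤ t₀ →
      2 * Module.finrank ℝ E * κ (A * t) ≤ q * (A * κ t) ∧ κ (A * t) ≤ A * κ t)
    (hCD : 3 * C * A ≤ (1 - q) * D) (hMD : 2 * M ≤ D * κ t₀) (k : ℕ) :
    OscillationLe u (a * (1 + (1 / 2) ^ k)) (t₀ / A ^ k) (D * κ (t₀ / A ^ k)) := by
  induction k with
  | zero =>
    intro x y _ _
    rw [pow_zero, div_one]
    linarith [(abs_le.1 (hM x)).1, (abs_le.1 (hM y)).2]
  | succ k ih =>
    have hscale : t₀ / A ^ k = A * (t₀ / A ^ (k + 1)) := by rw [pow_succ]; field_simp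
    have hsmall : A * (t₀ / A ^ (k + 1)) ≤ t₀ :=
      hscale ▸ div_le_self ht₀.le (one_le_pow₀ (by linarith))
    have hshrink : t₀ / A ^ k ≤ a / 2 * (1 / 2) ^ k := by
      rw [div_eq_mul_inv, ← inv_pow]
      gcongr
      exact inv_le_of_inv_le₀ (by norm_num) (by simpa using hA2)
    have hpow : (1 / 2 : ℝ) ^ k ≤ 1 := pow_le_one₀ (by norm_num) (by norm_num)
    obtain ⟨hcontr, hdouble⟩ := hcontr (t₀ / A ^ (k + 1)) (by positivity) hsmall
    have hstep := OscillationLe.step (hscale ▸ ih) havg hu hM hκ hA (by linarith) hC hD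
      (by positivity) (by nlinarith) hsmall (hsmall.trans ht₀l) hcontr hdouble hCD
    intro x y hx hxy
    refine hstep x y (hx.trans_le ?_) hxy
    rw [← hscale, pow_succ]
    linarith

theorem HasAverageModulus.exists_modulus {a s₀ τ : ℝ}
    (havg : HasAverageModulus μ u κ C (2 * a) s₀) (hs₀ : 0 < s₀) (hu : Measurable u)
    (hM : ∀ z, |u z| ≤ M) (hκ : IsModulusOfContinuity l κ) (hdim : 0 < Module.finrank ℝ E)
    (hA : 2 * Module.finrank ℝ E < A) (hq : q < 1) (hC : 0 ≤ C) (ha : 0 < a) (hτ : 0 < τ)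
    (hAτ : A * τ ≤ l)
    (hcontr : ∀ t, 0 < t → t ≤ τ → 2 * Module.finrank ℝ E * κ (A * t) ≤ q * (A * κ t)) :
    ∃ D t₀ : ℝ, 0 < D ∧ 0 < t₀ ∧ t₀ ≤ l ∧
      ∀ x y, ‖x‖ < a → ‖y - x‖ ≤ t₀ → u y - u x ≤ D * κ ‖y - x‖ := by
  have hdim1 : (1 : ℝ) ≤ Module.finrank ℝ E := by exact_mod_cast hdim
  have hA0 : 0 < A := by linarith
  obtain ⟨t₀, ht₀, ht₀τ, ht₀a, ht₀s⟩ : ∃ t₀ : ℝ, 0 < t₀ ∧ t₀ ≤ A * τ ∧ t₀ ≤ a / 2 ∧ t₀ ≤ s₀ :=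
    ⟨min (min (A * τ) (a / 2)) s₀, by positivity, (min_le_left _ _).trans (min_le_left _ _),
      (min_le_left _ _).trans (min_le_right _ _), min_le_right _ _⟩
  have ht₀l : t₀ ≤ l := ht₀τ.trans hAτ
  have hκ₀ : 0 < κ t₀ := hκ.pos t₀ ⟨ht₀, ht₀l⟩
  obtain ⟨D, hD, hMD, hCD⟩ : ∃ D : ℝ, 0 < D ∧ 2 * M / κ t₀ ≤ D ∧ 3 * C * A / (1 - q) ≤ D :=
    ⟨max 1 (max (2 * M / κ t₀) (3 * C * A / (1 - q))), lt_max_of_lt_left one_pos, by simp, by simp⟩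
  have hcontr' (t : ℝ) (ht : 0 < t) (hAt : A * t ≤ t₀) :
      2 * Module.finrank ℝ E * κ (A * t) ≤ q * (A * κ t) ∧ κ (A * t) ≤ A * κ t := by
    have hκt := hκ.pos t ⟨ht, by nlinarith⟩
    have hκAt := hκ.pos (A * t) ⟨by positivity, hAt.trans ht₀l⟩
    have h := hcontr t ht (le_of_mul_le_mul_left (hAt.trans ht₀τ) hA0)
    exact ⟨h, by nlinarith [mul_pos hA0 hκt]⟩
  have hosc := oscillationLe_scale (fun x hx s hs hst => havg x hx s hs (hst.trans ht₀s)) hu hM hκ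
    hA (by linarith) hC hD.le ha ht₀ ht₀a ht₀l hcontr'
    (by rwa [div_le_iff₀' (by linarith)] at hCD) (by rwa [div_le_iff₀ hκ₀] at hMD)
  exact ⟨D * A, t₀, by positivity, ht₀, ht₀l, fun x y hx hxy =>
    sub_le_of_forall_oscillationLe_scale hκ (by linarith) hD.le ht₀l
      (fun t ht hAt => (hcontr' t ht hAt).2)
      (fun k x y hx => hosc k x y (hx.trans_le (le_mul_of_one_le_right ha.le (by simp)))) hx hxy⟩

end Oscillation

/-! ### Charts and the Riemannian distance -/

section RiemannianDistance

open scoped NNReal ENNReal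

variable {E : Type*} [NormedAddCommGroup E] [NormedSpace ℝ E]
  {E' : Type*} [NormedAddCommGroup E'] [NormedSpace ℝ E']
  {H : Type*} [TopologicalSpace H] {I : ModelWithCorners ℝ E H}
  {M : Type*} [TopologicalSpace M] [ChartedSpace H M]
  [RiemannianBundle (fun x : M => TangentSpace I x)]

theorem edist_le_mul_pathELength {f : M → E'} {s : Set M} {C : ℝ≥0} {γ : ℝ → M} (hs : IsOpen s)
    (hf : ContMDiffOn I 𝓘(ℝ, E') 1 f s) (hγ : ContMDiffOn 𝓘(ℝ, ℝ) I 1 γ (Icc 0 1))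
    (hγs : MapsTo γ (Icc 0 1) s)
    (hC : ∀ t ∈ Icc (0 : ℝ) 1, ∀ v : TangentSpace I (γ t),
      ‖(show E' from mfderiv I 𝓘(ℝ, E') f (γ t) v)‖ₑ ≤ C * ‖v‖ₑ) :
    edist (f (γ 1)) (f (γ 0)) ≤ C * pathELength I γ 0 1 := by
  have hchain (t : ℝ) (ht : t ∈ Icc 0 1) : mfderivWithin 𝓘(ℝ, ℝ) 𝓘(ℝ, E') (f ∘ γ) (Icc 0 1) t 1
      = mfderiv I 𝓘(ℝ, E') f (γ t) (mfderivWithin 𝓘(ℝ, ℝ) I γ (Icc 0 1) t 1) := by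
    refine DFunLike.congr_fun (mfderiv_comp_mfderivWithin t
      ((hf.mdifferentiableOn one_ne_zero).mdifferentiableAt (hs.mem_nhds (hγs ht)))
      (hγ.mdifferentiableOn one_ne_zero t ht) ?_) 1
    exact uniqueMDiffWithinAt_iff_uniqueDiffWithinAt.2 (uniqueDiffOn_Icc zero_lt_one t ht)
  calc edist (f (γ 1)) (f (γ 0)) = ‖(f ∘ γ) 1 - (f ∘ γ) 0‖ₑ := edist_eq_enorm_sub _ _
    _ ≤ ∫⁻ t in Icc 0 1, ‖derivWithin (f ∘ γ) (Icc 0 1) t‖ₑ :=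
        enorm_sub_le_lintegral_derivWithin_Icc_of_contDiffOn_Icc
          (contMDiffOn_iff_contDiffOn.1 (hf.comp hγ hγs)) zero_le_one
    _ = ∫⁻ t in Icc 0 1,
          ‖(show E' from mfderivWithin 𝓘(ℝ, ℝ) 𝓘(ℝ, E') (f ∘ γ) (Icc 0 1) t 1)‖ₑ := by
        simp_rw [← fderivWithin_derivWithin, mfderivWithin_eq_fderivWithin]
        rfl
    _ ≤ ∫⁻ t in Icc 0 1, C * ‖mfderivWithin 𝓘(ℝ, ℝ) I γ (Icc 0 1) t 1‖ₑ :=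
        setLIntegral_mono' measurableSet_Icc fun t ht => by
          rw [hchain t ht]
          exact hC t ht _
    _ = C * pathELength I γ 0 1 := by
        rw [lintegral_const_mul' _ _ ENNReal.coe_ne_top,
          pathELength_eq_lintegral_mfderivWithin_Icc]

theorem riemannianEDist_le_pathELength_of_mem_Icc {γ : ℝ → M} {t : ℝ}
    (hγ : ContMDiffOn 𝓘(ℝ, ℝ) I 1 γ (Icc 0 1)) (ht : t ∈ Icc (0 : ℝ) 1) :
    riemannianEDist I (γ 0) (γ t) ≤ pathELength I γ 0 1 :=
  (riemannianEDist_le_pathELength (hγ.mono (Icc_subset_Icc le_rfl ht.2)) rfl rfl ht.1).trans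
    (pathELength_mono le_rfl ht.2)

variable [IsManifold I 1 M] [IsContinuousRiemannianBundle E (fun x : M => TangentSpace I x)]
  [RegularSpace M]

/- A path between two points of a ball that is shorter than the diameter stays in a ball of thrice
the radius. -/
theorem exists_edist_le_mul_riemannianEDist {f : M → E'} {s : Set M} {x : M} {C : ℝ≥0}
    (hs : IsOpen s) (hx : x ∈ s) (hf : ContMDiffOn I 𝓘(ℝ, E') 1 f s)
    (hC : ∀ᶠ y in 𝓝 x, ∀ v : TangentSpace I y,
      ‖(show E' from mfderiv I 𝓘(ℝ, E') f y v)‖ₑ ≤ C * ‖v‖ₑ) :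
    ∃ V ∈ 𝓝 x, ∀ y ∈ V, ∀ z ∈ V, edist (f z) (f y) ≤ C * riemannianEDist I y z := by
  obtain ⟨c, hc0, hc⟩ := setOfPred_riemannianEDist_lt_subset_nhds I
    (inter_mem hC (hs.mem_nhds hx))
  set δ := c / 3 with hδ
  have hcδ : (δ + (δ + δ) : ℝ≥0∞) = c := by
    rw [← ENNReal.coe_add, ← ENNReal.coe_add, hδ]
    congr 1
    ring
  refine ⟨_, eventually_riemannianEDist_lt I x (c := δ) (by positivity), fun y hy z hz => ?_⟩
  rw [mem_ofPred_eq] at hy hz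
  have hyz : riemannianEDist I y z < δ + δ := riemannianEDist_triangle.trans_lt
    (ENNReal.add_lt_add (riemannianEDist_comm.trans_lt hy) hz)
  have hshort (r : ℝ≥0∞) (hr : riemannianEDist I y z < r) : edist (f z) (f y) / C ≤ r := by
    obtain ⟨γ, rfl, rfl, hγ, hlength⟩ := exists_lt_of_riemannianEDist_lt (lt_min hr hyz)
    have hstay (t : ℝ) (ht : t ∈ Icc 0 1) : riemannianEDist I x (γ t) < c := by
      have hγt := (riemannianEDist_le_pathELength_of_mem_Icc hγ ht).trans_lt
        (hlength.trans_le (min_le_right _ _))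
      exact hcδ ▸ riemannianEDist_triangle.trans_lt (ENNReal.add_lt_add hy hγt)
    refine ENNReal.div_le_of_le_mul' ((edist_le_mul_pathELength hs hf hγ
      (fun t ht => (hc (hstay t ht)).2) fun t ht => (hc (hstay t ht)).1).trans ?_)
    gcongr
    exact hlength.le.trans (min_le_left _ _)
  rw [mul_comm, ← ENNReal.div_le_iff_le_mul (Or.inr hyz.ne_top) (Or.inl ENNReal.coe_ne_top)]
  exact le_of_forall_gt_imp_ge_of_dense hshort

theorem exists_edist_extChartAt_le_mul_riemannianEDist (x : M) :
    ∃ C : ℝ≥0, ∃ V ∈ 𝓝 x, ∀ y ∈ V, ∀ z ∈ V,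
      edist (extChartAt I x z) (extChartAt I x y) ≤ C * riemannianEDist I y z := by
  obtain ⟨C, -, hC⟩ := eventually_enorm_mfderiv_extChartAt_lt I x
  refine ⟨C, exists_edist_le_mul_riemannianEDist (chartAt H x).open_source
    (mem_chart_source H x) contMDiffOn_extChartAt ?_⟩
  filter_upwards [hC] with y hy v
  exact (ContinuousLinearMap.le_opENorm _ _).trans (mul_le_mul_left hy.le ‖v‖ₑ)

end RiemannianDistance

section HermitianMetric

open scoped NNReal

variable {n : ℕ} {X : Type*} [TopologicalSpace X] [ChartedSpace (Cn n) X]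
  [IsManifold 𝓘(ℂ, Cn n) ω X] {F : OpenPartialHomeomorph X (Cn n)}

theorem mem_maximalAtlas_real (hF : F ∈ IsManifold.maximalAtlas 𝓘(ℂ, Cn n) ω X) :
    F ∈ IsManifold.maximalAtlas 𝓘(ℝ, Cn n) ∞ X := by
  have hsmooth {G G' : OpenPartialHomeomorph X (Cn n)}
      (hG : G ∈ IsManifold.maximalAtlas 𝓘(ℂ, Cn n) ω X)
      (hG' : G' ∈ IsManifold.maximalAtlas 𝓘(ℂ, Cn n) ω X) :
      G.symm ≫ₕ G' ∈ contDiffGroupoid ∞ 𝓘(ℝ, Cn n) := by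
    rw [contDiffGroupoid, mem_groupoid_of_pregroupoid, ← OpenPartialHomeomorph.symm_source,
      OpenPartialHomeomorph.trans_symm_eq_symm_trans_symm, OpenPartialHomeomorph.symm_symm]
    simpa [contDiffPregroupoid, Function.comp_def] using
      And.intro (contDiffOn_symm_trans_of_mem_maximalAtlas hG hG')
        (contDiffOn_symm_trans_of_mem_maximalAtlas hG' hG)
  rw [IsManifold.mem_maximalAtlas_iff, mem_maximalAtlas_iff]
  intro e he
  have he' : e ∈ IsManifold.maximalAtlas 𝓘(ℂ, Cn n) ω X := IsManifold.subset_maximalAtlas he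
  exact ⟨hsmooth hF he', hsmooth he' hF⟩

namespace HermitianMetric

/-- The Riemannian structure of a Hermitian metric on the real tangent bundle. -/
noncomputable abbrev toRiemannianBundle (g : HermitianMetric n X) :
    RiemannianBundle (fun x : X => TangentSpace 𝓘(ℝ, Cn n) x) :=
  ⟨g.toContMDiffRiemannianMetric.toRiemannianMetric⟩

variable (g : HermitianMetric n X)

theorem isContinuousRiemannianBundle :
    letI := g.toRiemannianBundle
    IsContinuousRiemannianBundle (Cn n) (fun x : X => TangentSpace 𝓘(ℝ, Cn n) x) :=
  letI := g.toRiemannianBundle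
  ⟨⟨g.inner, g.contMDiff.continuous, fun _ _ _ => rfl⟩⟩

theorem continuousOn_inChart (hF : F ∈ IsManifold.maximalAtlas 𝓘(ℂ, Cn n) ω X) :
    ContinuousOn (fun p : Cn n × Cn n => g.inChart F p.1 p.2) (F.target ×ˢ univ) := by
  let := g.toRiemannianBundle
  have := g.isContinuousRiemannianBundle
  have htangent : ContinuousOn (fun p : Cn n × Cn n => (⟨F.symm p.1,
      mfderiv 𝓘(ℝ, Cn n) 𝓘(ℝ, Cn n) F.symm p.1 p.2⟩ : TangentBundle 𝓘(ℝ, Cn n) X))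
      (F.target ×ˢ univ) := by
    have hwithin := ((contMDiffOn_symm_of_mem_maximalAtlas
      (mem_maximalAtlas_real hF)).continuousOn_tangentMapWithin (by simp)
        F.open_target.uniqueMDiffOn).comp
      (tangentBundleModelSpaceHomeomorph 𝓘(ℝ, Cn n)).symm.continuous.continuousOn
      (s := F.target ×ˢ univ) fun p hp => hp.1
    refine hwithin.congr fun p hp => ?_
    change _ = (⟨F.symm p.1, mfderivWithin 𝓘(ℝ, Cn n) 𝓘(ℝ, Cn n) F.symm F.target p.1 p.2⟩ :
      TangentBundle 𝓘(ℝ, Cn n) X)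
    rw [mfderivWithin_of_isOpen F.open_target hp.1]
  exact ContinuousOn.inner_bundle (F := Cn n) (E := fun x : X => TangentSpace 𝓘(ℝ, Cn n) x)
    htangent htangent

theorem inChart_smul (F : OpenPartialHomeomorph X (Cn n)) (z ξ : Cn n) (t : ℝ) :
    g.inChart F z (t • ξ) = t ^ 2 * g.inChart F z ξ := by
  have hlinear : mfderiv 𝓘(ℝ, Cn n) 𝓘(ℝ, Cn n) F.symm z (t • ξ)
      = t • mfderiv 𝓘(ℝ, Cn n) 𝓘(ℝ, Cn n) F.symm z ξ := ContinuousLinearMap.map_smul _ _ _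
  rw [inChart, inChart, hlinear, map_smul, map_smul, smul_apply, smul_eq_mul, smul_eq_mul]
  ring

theorem exists_inChart_le (hF : F ∈ IsManifold.maximalAtlas 𝓘(ℂ, Cn n) ω X) {K : Set (Cn n)}
    (hK : IsCompact K) (hKF : K ⊆ F.target) :
    ∃ C : ℝ, 0 ≤ C ∧ ∀ z ∈ K, ∀ ξ, g.inChart F z ξ ≤ C * ‖ξ‖ ^ 2 := by
  obtain ⟨C, hC⟩ := (hK.prod (isCompact_closedBall (0 : Cn n) 1)).exists_bound_of_continuousOn
    ((g.continuousOn_inChart hF).mono (prod_mono hKF (subset_univ _)))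
  refine ⟨|C|, abs_nonneg C, fun z hz ξ => ?_⟩
  rcases eq_or_ne ξ 0 with rfl | hξ
  · simpa using (g.inChart_smul F z 0 0).le
  have hξ' : ‖ξ‖ ≠ 0 := norm_ne_zero_iff.2 hξ
  have hunit : ‖ξ‖⁻¹ • ξ ∈ Metric.closedBall (0 : Cn n) 1 := by
    rw [mem_closedBall_zero_iff, norm_smul, norm_inv, norm_norm, inv_mul_cancel₀ hξ']
  calc g.inChart F z ξ = ‖ξ‖ ^ 2 * g.inChart F z (‖ξ‖⁻¹ • ξ) := by
        rw [← g.inChart_smul, smul_inv_smul₀ hξ']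
    _ ≤ ‖ξ‖ ^ 2 * |C| := by
        gcongr
        exact (le_abs_self _).trans ((hC (z, ‖ξ‖⁻¹ • ξ) ⟨hz, hunit⟩).trans (le_abs_self C))
    _ = |C| * ‖ξ‖ ^ 2 := mul_comm _ _

variable [RegularSpace X]

/-- The geodesic distance of a Hermitian metric, as an extended pseudometric inducing the topology
of the manifold. -/
noncomputable abbrev pseudoEMetricSpace : PseudoEMetricSpace X :=
  letI := g.toRiemannianBundle
  letI := g.isContinuousRiemannianBundle
  .ofRiemannianMetric 𝓘(ℝ, Cn n) X

theorem exists_edist_le_mul_geodesicEDist (hF : F ∈ IsManifold.maximalAtlas 𝓘(ℂ, Cn n) ω X)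
    {x₀ : X} (hx₀ : x₀ ∈ F.source) :
    ∃ K : ℝ≥0, ∃ V ∈ 𝓝 x₀, ∀ x ∈ V, ∀ y ∈ V,
      edist (F y) (F x) ≤ K * g.geodesicEDist x y := by
  let := g.toRiemannianBundle
  have := g.isContinuousRiemannianBundle
  obtain ⟨C, V, hV, hchart⟩ :=
    exists_edist_extChartAt_le_mul_riemannianEDist (I := 𝓘(ℝ, Cn n)) x₀
  set e := chartAt (Cn n) x₀
  have hx₀e : x₀ ∈ e.source := mem_chart_source (Cn n) x₀
  have hmem : e x₀ ∈ (e.symm ≫ₕ F).source := by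
    simp [e.map_source hx₀e, e.left_inv hx₀e, hx₀]
  have htransition : ContDiffAt ℝ 1 (fun z => F (e.symm z)) (e x₀) :=
    ((contDiffOn_symm_trans_of_mem_maximalAtlas (IsManifold.chart_mem_maximalAtlas x₀) hF)
      |>.contDiffAt ((e.symm ≫ₕ F).open_source.mem_nhds hmem)).of_le (by simp)
  obtain ⟨L, t, ht, hlipschitz⟩ := htransition.exists_lipschitzOnWith
  refine ⟨L * C, V ∩ (e ⁻¹' t ∩ e.source),
    inter_mem hV (inter_mem ((e.continuousAt hx₀e).preimage_mem_nhds ht)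
      (e.open_source.mem_nhds hx₀e)), fun x hx y hy => ?_⟩
  calc edist (F y) (F x) ≤ L * edist (e y) (e x) := by
        simpa only [e.left_inv hy.2.2, e.left_inv hx.2.2] using hlipschitz hy.2.1 hx.2.1
    _ ≤ L * (C * g.geodesicEDist x y) := by gcongr; exact hchart x hx.1 y hy.1
    _ = (L * C : ℝ≥0) * g.geodesicEDist x y := by rw [ENNReal.coe_mul, mul_assoc]

end HermitianMetric

end HermitianMetric

/-! ### Functions on the manifold read in a chart -/

theorem lineLaplacian_eq_zero_of_notMem_tsupport {n : ℕ} {χ : Cn n → ℝ} {z : Cn n}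
    (hz : z ∉ tsupport χ) (ξ : Cn n) : lineLaplacian χ ξ z = 0 := by
  have hzero : fderiv ℝ (fderiv ℝ χ) z = 0 := image_eq_zero_of_notMem_tsupport
    fun h => hz (tsupport_fderiv_subset ℝ (tsupport_fderiv_subset ℝ h))
  simp [lineLaplacian_eq_fderiv, hzero]

section BallPullback

variable {n : ℕ} {X : Type*} [TopologicalSpace X]

/-- The function `φ` read in the chart `F` on the ball of radius `R`, extended by zero so that it
is bounded and measurable on all of `ℂⁿ`. -/
noncomputable def ballPullback (F : OpenPartialHomeomorph X (Cn n)) (R : ℝ) (φ : X → ℝ) :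
    Cn n → ℝ :=
  (Metric.ball (0 : Cn n) R).indicator fun z => φ (F.symm z)

variable {F : OpenPartialHomeomorph X (Cn n)} {R : ℝ} {φ : X → ℝ}

theorem ballPullback_of_lt {z : Cn n} (hz : ‖z‖ < R) : ballPullback F R φ z = φ (F.symm z) :=
  indicator_of_mem (mem_ball_zero_iff.2 hz) _

theorem abs_ballPullback_le {M : ℝ} (hM : ∀ x, |φ x| ≤ M) (z : Cn n) :
    |ballPullback F R φ z| ≤ M := by
  rw [ballPullback, ← Real.norm_eq_abs]
  exact (norm_indicator_le_norm_self _ z).trans (hM _)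

theorem measurable_ballPullback (hφ : UpperSemicontinuous φ)
    (hR : Metric.ball (0 : Cn n) R ⊆ F.target) : Measurable (ballPullback F R φ) := by
  have hsemi : UpperSemicontinuous
      ((Metric.ball (0 : Cn n) R).domRestrict fun z => φ (F.symm z)) :=
    hφ.comp (continuousOn_iff_continuous_domRestrict.1 (F.continuousOn_symm.mono hR))
  refine measurable_of_restrict_of_restrict_compl (measurableSet_ball (x := (0 : Cn n)) (ε := R))
    ?_ ?_
  · rw [ballPullback, domRestrict_eq_domRestrict_iff.2 eqOn_indicator]
    exact hsemi.measurable
  · rw [ballPullback, domRestrict_eq_domRestrict_iff.2 eqOn_indicator']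
    exact measurable_const

variable [ChartedSpace (Cn n) X] [IsManifold 𝓘(ℂ, Cn n) ω X]

theorem QuasiPlurisubharmonic.essentiallyAttainedAt_ballPullback
    (hφ : QuasiPlurisubharmonic (n := n) φ) (hF : F ∈ IsManifold.maximalAtlas 𝓘(ℂ, Cn n) ω X)
    (hR : Metric.ball (0 : Cn n) R ⊆ F.target) {z : Cn n} (hz : ‖z‖ < R) :
    EssentiallyAttainedAt volume (ballPullback F R φ) z := by
  have hzR : z ∈ Metric.ball (0 : Cn n) R := mem_ball_zero_iff.2 hz
  refine (hφ.essentiallyAttainedAt hF (hR hzR)).congr ?_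
  filter_upwards [Metric.isOpen_ball.mem_nhds hzR] with y hy
  exact (ballPullback_of_lt (mem_ball_zero_iff.1 hy)).symm

namespace HermitianMetric

variable {g : HermitianMetric n X}

theorem integrable_inChart_mul (hF : F ∈ IsManifold.maximalAtlas 𝓘(ℂ, Cn n) ω X)
    {χ : Cn n → ℝ} (hχ : Continuous χ) (hχc : HasCompactSupport χ) (hχF : tsupport χ ⊆ F.target)
    (ξ : Cn n) : Integrable fun z => g.inChart F z ξ * χ z := by
  have hcont : ContinuousOn (fun z => g.inChart F z ξ * χ z) (tsupport χ) :=
    ((g.continuousOn_inChart hF).comp (f := fun z => (z, ξ)) (by fun_prop)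
      fun z hz => ⟨hχF hz, mem_univ _⟩).mul hχ.continuousOn
  refine (integrableOn_iff_integrable_of_support_subset ?_).1 (hcont.integrableOn_compact hχc)
  exact (Function.support_mul_subset_right _ _).trans (subset_tsupport χ)

namespace IsPlurisubharmonic

theorem exists_distribLineLaplacianGe (hφ : g.IsPlurisubharmonic φ)
    (hF : F ∈ IsManifold.maximalAtlas 𝓘(ℂ, Cn n) ω X)
    (hR : Metric.closedBall (0 : Cn n) R ⊆ F.target)
    (hu : LocallyIntegrable (ballPullback F R φ)) :
    ∃ C : ℝ, 0 ≤ C ∧ DistribLineLaplacianGe (ballPullback F R φ) R C := by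
  obtain ⟨C, hC0, hC⟩ := g.exists_inChart_le hF (isCompact_closedBall (0 : Cn n) R) hR
  refine ⟨C, hC0, fun ξ χ hχ hχc hχR hχ0 => ?_⟩
  have hχF : tsupport χ ⊆ F.target := hχR.trans (Metric.ball_subset_closedBall.trans hR)
  have hχ₂ : ContDiff ℝ 2 χ := hχ.of_le (by norm_cast)
  have hpullback (z : Cn n) : φ (F.symm z) * lineLaplacian χ ξ z
      = ballPullback F R φ z * lineLaplacian χ ξ z := by
    by_cases hz : z ∈ tsupport χ
    · rw [ballPullback_of_lt (mem_ball_zero_iff.1 (hχR hz))]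
    · rw [lineLaplacian_eq_zero_of_notMem_tsupport hz, mul_zero, mul_zero]
  have hcurrent := hφ.2 F hF ξ χ hχ hχc hχF hχ0
  simp only [hpullback] at hcurrent
  have hlaplacian := integrable_mul_lineLaplacian hu hχ₂ hχc ξ
  refine hcurrent.trans (integral_mono
    ((integrable_inChart_mul hF hχ.continuous hχc hχF ξ).add hlaplacian)
    (((hχ.continuous.integrable_of_hasCompactSupport hχc).const_mul _).add hlaplacian)
    fun z => add_le_add_left ?_ _)
  by_cases hz : z ∈ tsupport χ
  · exact mul_le_mul_of_nonneg_right (hC z (Metric.ball_subset_closedBall (hχR hz)) ξ) (hχ0 z)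
  · simp [image_eq_zero_of_notMem_tsupport hz]

theorem exists_circularSubmean (hφ : g.IsPlurisubharmonic φ) {M : ℝ} (hM : ∀ x, |φ x| ≤ M)
    (hF : F ∈ IsManifold.maximalAtlas 𝓘(ℂ, Cn n) ω X)
    (hR : Metric.closedBall (0 : Cn n) R ⊆ F.target) :
    ∃ C : ℝ, 0 ≤ C ∧ CircularSubmean (ballPullback F R φ) R C := by
  have hball := Metric.ball_subset_closedBall.trans hR
  have hu := measurable_ballPullback hφ.1.upperSemicontinuous hball
  have huM (z : Cn n) := abs_ballPullback_le (F := F) (R := R) hM z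
  have hloc : LocallyIntegrable (ballPullback F R φ) :=
    (memLp_top_of_bound hu.aestronglyMeasurable M (Eventually.of_forall huM)).locallyIntegrable
      le_top
  obtain ⟨C, hC, hD⟩ := hφ.exists_distribLineLaplacianGe hF hR hloc
  refine ⟨C / 4, by positivity, fun b k hk x hx => ?_⟩
  rcases lt_or_ge ‖x‖ R with hxR | hxR
  · rw [div_mul_eq_mul_div]
    exact hk.submean hu huM hC hD (hφ.1.essentiallyAttainedAt_ballPullback hF hball hxR) hx
  · have hk0 : k = 0 := funext fun ξ => hk.support ξ (by linarith [norm_nonneg ξ])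
    simp [hk0]

end IsPlurisubharmonic

end HermitianMetric

end BallPullback

/-! ### The modulus of continuity in a chart -/

theorem IsRadialKernel.setIntegral_ball_eq {n : ℕ} {ρ : Cn n → ℝ} (hρ : IsRadialKernel ρ)
    (f : Cn n → ℝ) : ∫ ξ in Metric.ball (0 : Cn n) 1, f ξ * ρ ξ = ∫ ξ, f ξ * ρ ξ := by
  have hsphere : ∀ᵐ ξ : Cn n, ξ ∉ Metric.sphere (0 : Cn n) 1 :=
    measure_eq_zero_iff_ae_notMem.1 (Measure.addHaar_sphere_of_ne_zero volume 0 one_ne_zero)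
  refine setIntegral_eq_integral_of_ae_compl_eq_zero ?_
  filter_upwards [hsphere] with ξ hξ hξ'
  rw [mem_sphere_zero_iff_norm] at hξ
  rw [mem_ball_zero_iff, not_lt] at hξ'
  rw [hρ.support ξ (lt_of_le_of_ne hξ' (Ne.symm hξ)), mul_zero]

theorem mem_shrink_of_norm_add_lt {n : ℕ} (hn : 0 < n) {Ω : Set (Cn n)} (hΩ : IsOpen Ω)
    (hb : Bornology.IsBounded Ω) {R δ : ℝ} (hR : Metric.ball (0 : Cn n) R ⊆ Ω)
    {z : Cn n} (hδ : 0 < δ) (hz : ‖z‖ + δ < R) : z ∈ shrink Ω δ := by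
  have hzΩ : z ∈ Ω := hR (mem_ball_zero_iff.2 (by linarith))
  have : Nonempty (Fin n) := ⟨⟨0, hn⟩⟩
  have hfrontier : (frontier Ω).Nonempty := nonempty_frontier_iff.2
    ⟨⟨z, hzΩ⟩, fun h => NormedSpace.unbounded_univ ℝ (Cn n) (h ▸ hb)⟩
  refine ⟨hzΩ, (lt_sub_iff_add_lt'.2 hz).trans_le ((Metric.le_infDist hfrontier).2 fun y hy => ?_)⟩
  have hyR : R ≤ ‖y‖ := by
    by_contra! hlt
    exact (hΩ.frontier_eq ▸ hy).2 (hR (mem_ball_zero_iff.2 hlt))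
  rw [dist_comm, dist_eq_norm]
  linarith [norm_sub_norm_le y z]

theorem finrank_real_Cn (n : ℕ) : Module.finrank ℝ (Cn n) = 2 * n := by
  rw [finrank_real_of_complex, finrank_euclideanSpace, Fintype.card_fin]

section ChartModulus

variable {n : ℕ} {X : Type*} [TopologicalSpace X]
  {F : OpenPartialHomeomorph X (Cn n)} {l R : ℝ} {κ : ℝ → ℝ} {ρ : Cn n → ℝ} {φ : X → ℝ}

theorem regularize_comp_symm_eq_integral_ballPullback (hρ : IsRadialKernel ρ) {δ : ℝ} (hδ : 0 < δ)
    {z : Cn n} (hz : ‖z‖ + δ < R) :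
    regularize ρ δ (fun w => φ (F.symm w)) z = ∫ ξ, ballPullback F R φ (z + δ • ξ) * ρ ξ := by
  rw [regularize, ← hρ.setIntegral_ball_eq fun ξ => ballPullback F R φ (z + δ • ξ)]
  refine setIntegral_congr_fun measurableSet_ball fun ξ hξ => ?_
  rw [mem_ball_zero_iff] at hξ
  have hzξ : ‖z + δ • ξ‖ < R :=
    calc ‖z + δ • ξ‖ ≤ ‖z‖ + δ * ‖ξ‖ := by
          simpa only [norm_smul, Real.norm_of_nonneg hδ.le] using norm_add_le z (δ • ξ)
      _ < R := by nlinarith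
  simp only [ballPullback_of_lt hzξ]

theorem integral_ballPullback_le (hn : 0 < n) (hbdd : Bornology.IsBounded F.target)
    (hρ : IsRadialKernel ρ) (hR : Metric.ball (0 : Cn n) R ⊆ F.target) {δ B : ℝ} (hδ : 0 < δ)
    (hB : ∀ x ∈ F.source, F x ∈ shrink F.target δ → localRegularization ρ F δ φ x - φ x ≤ B)
    {z : Cn n} (hz : ‖z‖ + δ < R) :
    ∫ ξ, ballPullback F R φ (z + δ • ξ) * ρ ξ ≤ ballPullback F R φ z + B := by
  have hzF : z ∈ F.target := hR (mem_ball_zero_iff.2 (by linarith))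
  have hbound := hB (F.symm z) (F.map_target hzF) <| by
    rw [F.right_inv hzF]
    exact mem_shrink_of_norm_add_lt hn F.open_target hbdd hR hδ hz
  rw [localRegularization, F.right_inv hzF,
    regularize_comp_symm_eq_integral_ballPullback hρ hδ hz] at hbound
  rw [ballPullback_of_lt (by linarith)]
  linarith

variable [ChartedSpace (Cn n) X] [IsManifold 𝓘(ℂ, Cn n) ω X] {g : HermitianMetric n X}
  {M C₁ δ₁ : ℝ}

theorem exists_ballPullback_modulus (hn : 0 < n) (hκ : IsModulusOfContinuity l κ)
    (hgrowth : GrowthCondition n κ) (hρ : IsRadialKernel ρ) (hM : ∀ x, |φ x| ≤ M)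
    (hφ : g.IsPlurisubharmonic φ) (hF : F ∈ IsManifold.maximalAtlas 𝓘(ℂ, Cn n) ω X)
    (hbdd : Bornology.IsBounded F.target) {a : ℝ} (ha : 0 < a)
    (haF : Metric.closedBall (0 : Cn n) (4 * a) ⊆ F.target)
    (hC₁ : 0 < C₁) (hδ₁ : 0 < δ₁) (hδ₁l : δ₁ ≤ l)
    (hreg : ∀ δ : ℝ, 0 < δ → δ < δ₁ → ∀ x ∈ F.source, F x ∈ shrink F.target δ →
      localRegularization ρ F δ φ x - φ x ≤ C₁ * κ δ) :
    ∃ D t₀ : ℝ, 0 < D ∧ 0 < t₀ ∧ t₀ ≤ l ∧ ∀ z w, ‖z‖ < a → ‖w - z‖ ≤ t₀ →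
      ballPullback F (4 * a) φ w - ballPullback F (4 * a) φ z ≤ D * κ ‖w - z‖ := by
  have hball : Metric.ball (0 : Cn n) (4 * a) ⊆ F.target :=
    Metric.ball_subset_closedBall.trans haF
  have hum := measurable_ballPullback hφ.1.upperSemicontinuous hball
  have huM (z : Cn n) := abs_ballPullback_le (F := F) (R := 4 * a) hM z
  obtain ⟨C, hC, hsubmean⟩ := hφ.exists_circularSubmean hM hF haF
  obtain ⟨C', s₀, hC', hs₀, havg⟩ :=
    hsubmean.exists_hasAverageModulus ha hC hum huM hρ hκ hC₁ hδ₁ hδ₁l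
      fun δ hδ hδδ₁ z hz => integral_ballPullback_le hn hbdd hρ hball hδ (hreg δ hδ hδδ₁) hz
  obtain ⟨A, q, τ, hA, hq, hτ, hAτ, hcontr⟩ := hgrowth.exists_contraction hn hκ
  have hdim : (2 * Module.finrank ℝ (Cn n) : ℝ) = 4 * n := by
    rw [finrank_real_Cn]
    push_cast
    ring
  exact havg.exists_modulus hs₀ hum huM hκ (by rw [finrank_real_Cn]; lia) (hdim.trans_lt hA) hq hC'
    ha hτ hAτ (by rwa [hdim])

theorem exists_chart_modulus (hn : 0 < n) (hκ : IsModulusOfContinuity l κ)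
    (hgrowth : GrowthCondition n κ) (hρ : IsRadialKernel ρ) (hM : ∀ x, |φ x| ≤ M)
    (hφ : g.IsPlurisubharmonic φ) (hreg : LocalRegularizationBound l κ ρ φ) (x₀ : X) :
    ∃ F ∈ IsManifold.maximalAtlas 𝓘(ℂ, Cn n) ω X, x₀ ∈ F.source ∧
      ∃ D : ℝ, 0 < D ∧ ∃ W ∈ 𝓝 x₀, ∀ x ∈ W, ∀ y ∈ W,
        ‖F y - F x‖ ≤ l ∧ φ y - φ x ≤ D * κ ‖F y - F x‖ := by
  obtain ⟨F, hF, C₁, δ₁, hC₁, hδ₁, hδ₁l, hbound⟩ := hreg x₀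
  have h0 : (0 : Cn n) ∈ F.target := hF.map_center ▸ F.map_source hF.mem_source
  obtain ⟨r, hr, hrF⟩ := Metric.nhds_basis_closedBall.mem_iff.1 (F.open_target.mem_nhds h0)
  obtain ⟨a, rfl⟩ : ∃ a, r = 4 * a := ⟨r / 4, by ring⟩
  have ha : 0 < a := by linarith
  obtain ⟨D, t₀, hD, ht₀, ht₀l, hmod⟩ := exists_ballPullback_modulus hn hκ hgrowth hρ hM hφ
    hF.holomorphic hF.bounded ha hrF hC₁ hδ₁ hδ₁l hbound
  have hb : 0 < min a (t₀ / 2) := by positivity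
  have hcenter : F ⁻¹' Metric.ball 0 (min a (t₀ / 2)) ∈ 𝓝 x₀ :=
    (F.continuousAt hF.mem_source).preimage_mem_nhds
      (hF.map_center.symm ▸ Metric.ball_mem_nhds _ hb)
  refine ⟨F, hF.holomorphic, hF.mem_source, D, hD, F.source ∩ F ⁻¹' Metric.ball 0 _,
    inter_mem (F.open_source.mem_nhds hF.mem_source) hcenter, fun x hx y hy => ?_⟩
  obtain ⟨hxa, hxt⟩ := lt_min_iff.1 (mem_ball_zero_iff.1 hx.2)
  obtain ⟨hya, hyt⟩ := lt_min_iff.1 (mem_ball_zero_iff.1 hy.2)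
  have hxy : ‖F y - F x‖ ≤ t₀ := (norm_sub_le _ _).trans (by linarith)
  have hle := hmod (F x) (F y) hxa hxy
  rw [ballPullback_of_lt (by linarith), ballPullback_of_lt (by linarith), F.left_inv hx.1,
    F.left_inv hy.1] at hle
  exact ⟨hxy.trans ht₀l, hle⟩

end ChartModulus

/-! ### From local to global moduli of continuity -/

theorem toReal_min_ofReal_mem_Icc {l : ℝ} (hl : 0 ≤ l) (d : ENNReal) :
    (min d (ENNReal.ofReal l)).toReal ∈ Icc 0 l :=
  ⟨ENNReal.toReal_nonneg, ENNReal.toReal_le_of_le_ofReal hl (min_le_right _ _)⟩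

namespace IsModulusOfContinuity

variable {l : ℝ} {κ : ℝ → ℝ}

theorem le_mul_of_le_mul (hκ : IsModulusOfContinuity l κ) {K s t : ℝ} (hs : s ∈ Icc 0 l)
    (ht : t ∈ Icc 0 l) (hK : 0 ≤ K) (hst : s ≤ K * t) : κ s ≤ (K + 1) * κ t := by
  have hκt := hκ.nonneg ht
  rcases hs.1.eq_or_lt with rfl | hs0
  · rw [hκ.map_zero]
    positivity
  have ht0 : 0 < t := pos_of_mul_pos_right (hs0.trans_le hst) hK
  have hcancel : s / t * t = s := div_mul_cancel₀ s ht0.ne'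
  calc κ s = κ (s / t * t) := by rw [hcancel]
    _ ≤ (s / t + 1) * κ t := hκ.mul_le (div_pos hs0 ht0) ht (hcancel.trans_le hs.2)
    _ ≤ (K + 1) * κ t := by
        gcongr
        exact (div_le_iff₀ ht0).2 hst

theorem le_mul_min_of_ofReal_le_mul (hκ : IsModulusOfContinuity l κ) {s : ℝ} (hs : s ∈ Icc 0 l)
    {K : NNReal} {d : ENNReal} (hd : ENNReal.ofReal s ≤ K * d) :
    κ s ≤ (K + 1) * κ (min d (ENNReal.ofReal l)).toReal := by
  have hl := hκ.length_pos
  have hmem := toReal_min_ofReal_mem_Icc hl.le d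
  rcases le_total (ENNReal.ofReal l) d with hld | hdl
  · rw [min_eq_right hld, ENNReal.toReal_ofReal hl.le] at hmem ⊢
    calc κ s ≤ κ l := hκ.monotoneOn hs hmem hs.2
      _ ≤ (K + 1) * κ l := le_mul_of_one_le_left (hκ.nonneg hmem) (by simp)
  · rw [min_eq_left hdl] at hmem ⊢
    refine hκ.le_mul_of_le_mul hs hmem K.coe_nonneg ?_
    have hdtop : d ≠ ⊤ := ne_top_of_le_ne_top ENNReal.ofReal_ne_top hdl
    simpa using (ENNReal.ofReal_le_iff_le_toReal (ENNReal.mul_ne_top ENNReal.coe_ne_top hdtop)).1 hd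

variable {X : Type*} [PseudoEMetricSpace X] {φ : X → ℝ} {M : ℝ}

theorem exists_semilocal_modulus (hκ : IsModulusOfContinuity l κ) (hM : ∀ x, |φ x| ≤ M) {x₀ : X}
    {D : ℝ} (hD : 0 < D) {W : Set X} (hW : W ∈ 𝓝 x₀)
    (hmod : ∀ x ∈ W, ∀ y ∈ W,
      |φ x - φ y| ≤ D * κ (min (edist x y) (ENNReal.ofReal l)).toReal) :
    ∃ V ∈ 𝓝 x₀, ∃ D' : ℝ, 0 < D' ∧ ∀ x ∈ V, ∀ y,
      |φ x - φ y| ≤ D' * κ (min (edist x y) (ENNReal.ofReal l)).toReal := by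
  have hl := hκ.length_pos
  have hM0 : 0 ≤ M := (abs_nonneg _).trans (hM x₀)
  obtain ⟨c, hc, hcW⟩ := EMetric.mem_nhds_iff.1 hW
  have hc2 : 0 < c / 2 := ENNReal.half_pos hc.ne'
  have hmem (d : ENNReal) := toReal_min_ofReal_mem_Icc hl.le d
  have hmin_ne_top (d : ENNReal) : min d (ENNReal.ofReal l) ≠ ⊤ :=
    ne_top_of_le_ne_top ENNReal.ofReal_ne_top (min_le_right _ _)
  set m₀ := (min (c / 2) (ENNReal.ofReal l)).toReal
  have hκm₀ : 0 < κ m₀ := hκ.pos _ ⟨ENNReal.toReal_pos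
    (lt_min hc2 (ENNReal.ofReal_pos.2 hl)).ne' (hmin_ne_top _), (hmem _).2⟩
  refine ⟨Metric.eball x₀ (c / 2), Metric.eball_mem_nhds _ hc2, D + 2 * M / κ m₀, by positivity,
    fun x hx y => ?_⟩
  have hnonneg := hκ.nonneg (hmem (edist x y))
  rcases lt_or_ge (edist x y) (c / 2) with hnear | hfar
  · have hy : edist y x₀ < c :=
      calc edist y x₀ ≤ edist y x + edist x x₀ := edist_triangle _ _ _
        _ < c / 2 + c / 2 := ENNReal.add_lt_add (edist_comm x y ▸ hnear) hx
        _ = c := ENNReal.add_halves c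
    refine (hmod x (hcW (lt_of_lt_of_le hx ENNReal.half_le_self)) y (hcW hy)).trans ?_
    gcongr
    exact le_add_of_nonneg_right (by positivity)
  · have hκ_le : κ m₀ ≤ κ (min (edist x y) (ENNReal.ofReal l)).toReal :=
      hκ.monotoneOn (hmem _) (hmem _)
        (ENNReal.toReal_mono (hmin_ne_top _) (min_le_min_right _ hfar))
    calc |φ x - φ y| ≤ 2 * M := (abs_sub _ _).trans (by linarith [hM x, hM y])
      _ = 2 * M / κ m₀ * κ m₀ := (div_mul_cancel₀ _ hκm₀.ne').symm
      _ ≤ (D + 2 * M / κ m₀) * κ (min (edist x y) (ENNReal.ofReal l)).toReal := by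
          gcongr
          exact le_add_of_nonneg_left hD.le

theorem exists_global_modulus [CompactSpace X] (hκ : IsModulusOfContinuity l κ)
    (hM : ∀ x, |φ x| ≤ M)
    (hloc : ∀ x₀ : X, ∃ D : ℝ, 0 < D ∧ ∃ W ∈ 𝓝 x₀, ∀ x ∈ W, ∀ y ∈ W,
      |φ x - φ y| ≤ D * κ (min (edist x y) (ENNReal.ofReal l)).toReal) :
    ∃ D : ℝ, 0 < D ∧ ∀ x y, |φ x - φ y| ≤ D * κ (min (edist x y) (ENNReal.ofReal l)).toReal := by
  suffices h : ∃ D : ℝ, 0 < D ∧ ∀ x ∈ (univ : Set X), ∀ y,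
      |φ x - φ y| ≤ D * κ (min (edist x y) (ENNReal.ofReal l)).toReal by simpa using h
  refine isCompact_univ.induction_on (p := fun s => ∃ D : ℝ, 0 < D ∧ ∀ x ∈ s, ∀ y,
    |φ x - φ y| ≤ D * κ (min (edist x y) (ENNReal.ofReal l)).toReal) ⟨1, one_pos, by simp⟩ ?_ ?_ ?_
  · rintro s t hst ⟨D, hD, hmod⟩
    exact ⟨D, hD, fun x hx => hmod x (hst hx)⟩
  · rintro s t ⟨D, hD, hs⟩ ⟨D', -, ht⟩
    refine ⟨max D D', lt_max_of_lt_left hD, fun x hx y => ?_⟩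
    have hnonneg := hκ.nonneg (toReal_min_ofReal_mem_Icc hκ.length_pos.le (edist x y))
    rcases hx with hx | hx
    · exact (hs x hx y).trans (mul_le_mul_of_nonneg_right (le_max_left _ _) hnonneg)
    · exact (ht x hx y).trans (mul_le_mul_of_nonneg_right (le_max_right _ _) hnonneg)
  · intro x₀ _
    obtain ⟨D, hD, W, hW, hmod⟩ := hloc x₀
    obtain ⟨V, hV, hmodV⟩ := hκ.exists_semilocal_modulus hM hD hW hmod
    exact ⟨V, mem_nhdsWithin_of_mem_nhds hV, hmodV⟩

end IsModulusOfContinuity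

theorem exists_local_geodesic_modulus {n : ℕ} {X : Type*} [TopologicalSpace X] [RegularSpace X]
    [ChartedSpace (Cn n) X] [IsManifold 𝓘(ℂ, Cn n) ω X] {g : HermitianMetric n X} {l M : ℝ}
    {κ : ℝ → ℝ} {ρ : Cn n → ℝ} {φ : X → ℝ} (hκ : IsModulusOfContinuity l κ)
    (hgrowth : GrowthCondition n κ) (hρ : IsRadialKernel ρ) (hM : ∀ x, |φ x| ≤ M)
    (hφ : g.IsPlurisubharmonic φ) (hreg : LocalRegularizationBound l κ ρ φ) (x₀ : X) :
    ∃ D : ℝ, 0 < D ∧ ∃ W ∈ 𝓝 x₀, ∀ x ∈ W, ∀ y ∈ W,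
      |φ x - φ y| ≤ D * κ (min (g.geodesicEDist x y) (ENNReal.ofReal l)).toReal := by
  rcases Nat.eq_zero_or_pos n with rfl | hn
  · obtain ⟨F, hF, -⟩ := hreg x₀
    refine ⟨1, one_pos, F.source, F.open_source.mem_nhds hF.mem_source, fun x hx y hy => ?_⟩
    rw [F.injOn hx hy (Subsingleton.elim _ _), sub_self, abs_zero, one_mul]
    exact hκ.nonneg (toReal_min_ofReal_mem_Icc hκ.length_pos.le _)
  obtain ⟨F, hF, hx₀, D, hD, W, hW, hmod⟩ := exists_chart_modulus hn hκ hgrowth hρ hM hφ hreg x₀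
  obtain ⟨K, V, hV, hlip⟩ := g.exists_edist_le_mul_geodesicEDist hF hx₀
  refine ⟨D * (K + 1), by positivity, W ∩ V, inter_mem hW hV, fun x hx y hy => ?_⟩
  obtain ⟨hxy, hle⟩ := hmod x hx.1 y hy.1
  have hge := (hmod y hy.1 x hx.1).2
  rw [norm_sub_rev] at hge
  have hdist := hlip x hx.2 y hy.2
  rw [edist_dist, dist_eq_norm] at hdist
  calc |φ x - φ y| ≤ D * κ ‖F y - F x‖ := abs_le.2 ⟨by linarith, hge⟩
    _ ≤ D * ((K + 1) * κ (min (g.geodesicEDist x y) (ENNReal.ofReal l)).toReal) := by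
        gcongr
        exact hκ.le_mul_min_of_ofReal_le_mul ⟨norm_nonneg _, hxy⟩ hdist
    _ = D * (K + 1) * κ (min (g.geodesicEDist x y) (ENNReal.ofReal l)).toReal := by ring

theorem mainTheorem3 {n : ℕ} {X : Type*} [TopologicalSpace X] [T2Space X] [CompactSpace X]
    [ChartedSpace (Cn n) X] [IsManifold 𝓘(ℂ, Cn n) ω X] (g : HermitianMetric n X)
    (l : ℝ) (κ : ℝ → ℝ) (hκ : IsModulusOfContinuity l κ) (hgrowth : GrowthCondition n κ)
    (ρ : Cn n → ℝ) (hρ : IsRadialKernel ρ)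
    (φ : X → ℝ) (hbdd : ∃ M : ℝ, ∀ x, |φ x| ≤ M) (hφ : g.IsPlurisubharmonic φ)
    (hreg : LocalRegularizationBound l κ ρ φ) :
    ∃ C₂ : ℝ, 0 < C₂ ∧ ∀ x y : X,
      |φ x - φ y| ≤ C₂ * κ (min (g.geodesicEDist x y) (ENNReal.ofReal l)).toReal := by
  obtain ⟨M, hM⟩ := hbdd
  let := g.pseudoEMetricSpace
  exact hκ.exists_global_modulus hM (exists_local_geodesic_modulus hκ hgrowth hρ hM hφ hreg)
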